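/- **Model.** There are $L\ge 1$ drivers. A state $(l,m)$, $0\le l\le L$, $m\ge 0$, has $l$ drivers in service and $m$ riders in the queue. A policy $(\lambda,\phi)$ consists of request rates $\lambda(l,m)\in[0,\Lambda]$, $\Lambda>0$, and a dispatching rule $\phi(l,m)\in\{0,1\}$ with $\phi(l,0)=\phi(L,m)=0$. Riders join at rate $\lambda(l,m)$, giving $(l,m+1)$; trips are completed at rate $l\mu_{l,m}$, giving $(l-1,m)$; after each event, as long as $\phi=1$ in the current state $(l,m)$, the state moves instantaneously to $(l+1,m-1)$. Here $0<\mu_{l,m}\le\bar\mu$. The price per kilometre $p_1(\lambda)\in[0,p_{\max}]$ is determined by $\lambda=\Lambda(1-F(p_1))$, where $F$ is a strictly increasing bijection from $[0,p_{\max}]$ onto $[0,1]$. The objective is $$\sum_{(l,m)}\pi(l,m)\Big(\lambda(l,m)\big(p_0+w_p^rt_0+p_1(\lambda(l,m))\,t_0\big)-c_d\,l-c_r\,m\Big),$$ with $\pi$ a stationary distribution of the policy, $p_0\ge 0$, $t_0>0$, positive weights $w_s^d,w_o^d,w_p^r,w_q^r$, $c_d=w_s^d+w_p^r-w_o^d$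 and $c_r=w_q^r$; it is $-\infty$ if there is no stationary distribution or the mean queue length is infinite. A policy is optimal if it has a unique stationary distribution and the resulting objective is at least that of every policy in every stationary distribution of it. A state $(l,m)$ is of *type 1* if $l=L$ or $m=0$ or $l\mu_{l,m}>(l+1)\mu_{l+1,m-1}$, and of *type 2* otherwise. Let $\phi^*$ be the rule that is $0$ on type-1 states and $1$ on type-2 states. Its zigzag path starts at $(0,0)$ and moves from $(l,m)$ to $(l+1,m)$ if $\phi^*(l,m+1)=1$ and to $(l,m+1)$ otherwise. **Algorithm** (queue bound $M\ge 0$). For a path $P=(s_1,\dots,s_I)$ and request rates $\lambda$, with new riders rejected in $s_I$ (that is, $\lambda(s_I)$ is replaced by $0$), let $\tilde{\mathcal R}(\lambda,P)$ be the objective of the birth–death chain on $P$, whose stationary distribution is $\pi(s_i)\propto\prod_{j=1}^{i-1}\lambda(s_j)/r(s_{j+1})$ with $r(l,m)=l\mu_{l,m}$. Let $V(P)=\sup_{\bar\lambda\in[0,\Lambda]}\tilde{\mathcal R}(\bar\lambda,P)$ over constant rates. Put $P_{0,m}=((0,m))$, $R_{0,m}=0$, $P_{l,0}=((0,0),\dots,(l,0))$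 and $R_{l,0}=\max\{R_{l-1,0},V(P_{l,0})\}$. For $m=1,\dots,M$ and $l=1,\dots,L$ append $(l,m)$ to $P_{l-1,m}$ and to $P_{l,m-1}$, giving $P_{\rm above}$ and $P_{\rm left}$; let $\mathcal R_{\rm above}=\max\{R_{l-1,m},V(P_{\rm above})\}$ and $\mathcal R_{\rm left}=\max\{R_{l,m-1},V(P_{\rm left})\}$; let $(P_{l,m},R_{l,m})$ be the path with the larger value together with that value, where on a tie $P_{l,m}=P_{\rm above}$ if $(l-1,m)$ is of type 1 and $P_{l,m}=P_{\rm left}$ otherwise. The output is the path $P_{L,M}$, the dispatching rule that is $1$ exactly at the states $(l,m)$ with $l<L$ that lie to the right of all states of $P_{L,M}$ in row $l$, and a request-rate function $\lambda^*$ that maximizes $\tilde{\mathcal R}(\cdot,P_{L,M})$, with riders rejected in the last state and off the path. **Theorem.** Assume $c_d=c_r$ and that, on $0\le l\le L$, $m\ge0$, 1. $l\mu_{l,m+1}-l\mu_{l,m}$ is non-increasing in $m$ and non-decreasing in $l$; 2. $(l+1)\mu_{l+1,m}-l\mu_{l,m}$ (for $l<L$) is non-increasing in $l$ and non-decreasing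 in $m$. Then for every $M\ge 0$: - $P_{L,M}$ begins with the part of the zigzag path of $\phi^*$ that lies in $\{m\le M\}$. - The returned dispatching rule is $0$ on all type-1 states and $1$ on all type-2 states with $m\le M$. - A maximizer $\lambda^*$ exists, and for each one the returned policy is optimal when only stationary distributions supported on $\{m\le M\}$ are allowed. - If moreover $c_rM\ge L\bar\mu\,(p_0+w_p^rt_0+p_{\max}t_0)$, then the returned policy is optimal among all policies, without any bound on the queue, and so is the policy that uses $\lambda^*$ together with $\phi^*$ on the whole state space. -/

import Mathlib

open Set

noncomputable section

namespace SpatialQueue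

/-- A state `(l, m)`: `l` drivers in service, `m` riders waiting in the queue. The actual states of
a model with `L` drivers are those with `l ≤ L`. -/
abbrev State := ℕ × ℕ

/-- The data of the ride-hailing platform. -/
structure Model where
  /-- total number of drivers -/
  L : ℕ
  one_le_L : 1 ≤ L
  /-- rate of arrival of riders, before pricing -/
  Lam : ℝ
  Lam_pos : 0 < Lam
  /-- service rate of each busy driver in each state, and an upper bound for it -/
  mu : State → ℝ
  muBar : ℝ
  mu_pos : ∀ l ≤ L, ∀ m, 0 < mu (l, m)
  mu_le : ∀ l ≤ L, ∀ m, mu (l, m) ≤ muBar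
  /-- base fare -/
  p0 : ℝ
  p0_nonneg : 0 ≤ p0
  /-- mean on-trip time -/
  t0 : ℝ
  t0_pos : 0 < t0
  /-- largest per-kilometre price -/
  pMax : ℝ
  pMax_pos : 0 < pMax
  /-- distribution function of the willingness to pay per kilometre, on `[0, pMax]` -/
  F : ℝ → ℝ
  F_zero : F 0 = 0
  F_pMax : F pMax = 1
  F_strictMono : StrictMonoOn F (Icc 0 pMax)
  F_surj : SurjOn F (Icc 0 pMax) (Icc 0 1)
  /-- unit costs: driver in service, idle driver, rider waiting for pick-up, rider in the queue -/
  wSD : ℝ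
  wOD : ℝ
  wPR : ℝ
  wQR : ℝ
  wSD_pos : 0 < wSD
  wOD_pos : 0 < wOD
  wPR_pos : 0 < wPR
  wQR_pos : 0 < wQR

namespace Model

variable (D : Model)

/-- Driver-side penalty coefficient. -/
def cd : ℝ := D.wSD + D.wPR - D.wOD

/-- Rider-side penalty coefficient. -/
def cr : ℝ := D.wQR

/-- Total service (trip completion) rate `l μ_{l,m}`. -/
def serviceRate (s : State) : ℝ := (s.1 : ℝ) * D.mu s

/-- The per-kilometre price `p₁(x)` at which the effective request rate `Λ (1 - F p₁)` is `x`. -/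
def unitPrice (x : ℝ) : ℝ := Function.invFunOn (fun p => D.Lam * (1 - D.F p)) (Icc 0 D.pMax) x

/-- Payoff per accepted rider at effective request rate `x`. -/
def fare (x : ℝ) : ℝ := D.p0 + D.wPR * D.t0 + D.unitPrice x * D.t0

/-- The largest possible payoff per rider. -/
def fareMax : ℝ := D.p0 + D.wPR * D.t0 + D.pMax * D.t0

/-- Reward rate in state `s` at effective request rate `x`. -/
def reward (x : ℝ) (s : State) : ℝ := x * D.fare x - D.cd * s.1 - D.cr * s.2

/-- The diminishing-returns conditions on the total service rates. -/
structure DiminishingReturns : Prop where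
  incr_m_anti_m : ∀ l ≤ D.L,
    Antitone fun m : ℕ => D.serviceRate (l, m + 1) - D.serviceRate (l, m)
  incr_m_mono_l : ∀ m : ℕ,
    MonotoneOn (fun l : ℕ => D.serviceRate (l, m + 1) - D.serviceRate (l, m)) (Iic D.L)
  incr_l_anti_l : ∀ m : ℕ,
    AntitoneOn (fun l : ℕ => D.serviceRate (l + 1, m) - D.serviceRate (l, m)) (Iio D.L)
  incr_l_mono_m : ∀ l < D.L,
    Monotone fun m : ℕ => D.serviceRate (l + 1, m) - D.serviceRate (l, m)

/-- Type 1 states (for `l ≤ L`). -/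
def Type1 (s : State) : Prop :=
  s.1 = D.L ∨ s.2 = 0 ∨ D.serviceRate (s.1 + 1, s.2 - 1) < D.serviceRate s

/-- Type 2 states. -/
def Type2 (s : State) : Prop :=
  s.1 < D.L ∧ s.2 ≠ 0 ∧ D.serviceRate s ≤ D.serviceRate (s.1 + 1, s.2 - 1)

end Model

/-! ### Policies, the controlled Markov chain, and optimality -/

/-- A policy: in each state, whether to dispatch (`true`) or hold (`false`), and the effective
request rate (equivalently, the price). -/
structure Policy where
  dispatch : State → Bool
  rate : State → ℝ

/-- The state in which the system comes to rest when, from `(l, m)`, drivers are dispatched one by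
one, instantaneously, until the dispatching rule says hold. -/
def settle (φ : State → Bool) : ℕ → ℕ → State
  | l, 0 => (l, 0)
  | l, m + 1 => if φ (l, m + 1) then settle φ (l + 1) m else (l, m + 1)

namespace Model

variable (D : Model)

/-- Rates lie in `[0, Λ]`, and there is no dispatch without a queueing rider and an idle driver. -/
structure Admissible (q : Policy) : Prop where
  rate_mem : ∀ l ≤ D.L, ∀ m, q.rate (l, m) ∈ Icc 0 D.Lam
  hold_no_rider : ∀ l ≤ D.L, q.dispatch (l, 0) = false
  hold_no_driver : ∀ m, q.dispatch (D.L, m) = false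

open Classical in
/-- Transition rate from `s` to `t`: a rider joins, or a trip is completed (rate `0` if no driver
is in service), in either case followed by the dispatches that the policy prescribes. -/
def transRate (q : Policy) (s t : State) : ℝ :=
  (if settle q.dispatch s.1 (s.2 + 1) = t then q.rate s else 0) +
  (if settle q.dispatch (s.1 - 1) s.2 = t then D.serviceRate s else 0)

/-- `π` is a stationary distribution of the chain under `q`. It gives no mass to states that the
policy leaves at once by a dispatch. All total jump rates are bounded, so that stationarity is the
global balance equation. A transition changes `l + m` by one, so a state has no jump to itself and
the sum on the right has finitely many nonzero terms. -/
structure IsStationary (q : Policy) (π : State → ℝ) : Prop where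
  nonneg : ∀ s, 0 ≤ π s
  hasSum_one : HasSum π 1
  support_states : ∀ s, D.L < s.1 → π s = 0
  support_hold : ∀ s, q.dispatch s = true → π s = 0
  balance : ∀ t, π t * (q.rate t + D.serviceRate t) = ∑' s, π s * D.transRate q s t

/-- `v` is the long-run average objective (revenue rate minus penalty rates) in the stationary
regime `π`. Reward rates are bounded above, so when `c_r > 0` the sum fails to converge only if it
is `-∞`, that is, if the mean queue length is infinite. -/
def HasObjective (q : Policy) (π : State → ℝ) (v : ℝ) : Prop :=
  HasSum (fun s => π s * D.reward (q.rate s) s) v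

/-- `q` is optimal for the objective among all policies, where only stationary regimes with
property `A` count. The policy `q` has exactly one stationary regime; the competitors may have
several, and each of them is beaten. Policies without a stationary regime, or with infinite mean
queue length, have objective `-∞`. -/
def IsOptimalAmong (A : (State → ℝ) → Prop) (q : Policy) : Prop :=
  D.Admissible q ∧ ∃ π v, D.IsStationary q π ∧ (∀ π', D.IsStationary q π' → π' = π) ∧ A π ∧
    D.HasObjective q π v ∧
    ∀ q' π' v', D.Admissible q' → D.IsStationary q' π' → A π' → D.HasObjective q' π' v' → v' ≤ v

/-- Optimality among all policies. -/
def IsOptimal (q : Policy) : Prop := D.IsOptimalAmong (fun _ => True) q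

/-- Optimality when the queue may never hold more than `M` riders. -/
def IsOptimalQueueBounded (M : ℕ) (q : Policy) : Prop :=
  D.IsOptimalAmong (fun π => ∀ s : State, M < s.2 → π s = 0) q

/-! ### Zigzag paths -/

open Classical in
/-- The dispatching rule that holds on type 1 states and dispatches on type 2 states. -/
def typeRule (s : State) : Bool := decide (D.Type2 s)

/-- The (infinite) zigzag path from `(0, 0)` of a dispatching rule: a step down, to `(l + 1, m)`, if
the rule dispatches at `(l, m + 1)`, and a step to the right, to `(l, m + 1)`, otherwise. -/
def zigzag (φ : State → Bool) : ℕ → State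
  | 0 => (0, 0)
  | k + 1 =>
    let s := zigzag φ k
    if φ (s.1, s.2 + 1) then (s.1 + 1, s.2) else (s.1, s.2 + 1)

open Classical in
/-- The dispatching policy of a finite path: dispatch exactly in the states to the right of it (and
never when all drivers are busy). -/
def pathDispatch (P : List State) (s : State) : Bool :=
  decide (s.1 < D.L ∧ (∃ m, (s.1, m) ∈ P) ∧ ∀ m, (s.1, m) ∈ P → m < s.2)

/-- Request rates along a path: `x` before the last state; new riders are rejected in the last
state (and off the path). -/
def pathRate (P : List State) (x : State → ℝ) (s : State) : ℝ :=
  if s ∈ P.dropLast then x s else 0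

/-- The `i`-th state of a path, counted from `0`. -/
def nth (P : List State) (i : ℕ) : State := P.getD i (0, 0)

/-- Unnormalised stationary weight of the `i`-th state of a path (a birth-death chain). -/
def pathWeight (P : List State) (x : State → ℝ) (i : ℕ) : ℝ :=
  ∏ j ∈ Finset.range i, pathRate P x (nth P j) / D.serviceRate (nth P (j + 1))

/-- The objective of the path `P` with request rates `x`, through its closed-form stationary
distribution. -/
def pathValue (P : List State) (x : State → ℝ) : ℝ :=
  ∑ i ∈ Finset.range P.length,
    D.pathWeight P x i / (∑ k ∈ Finset.range P.length, D.pathWeight P x k) *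
      D.reward (pathRate P x (nth P i)) (nth P i)

/-- The best objective of a path under static pricing. -/
def staticValue (P : List State) : ℝ :=
  sSup ((fun r : ℝ => D.pathValue P (fun _ => r)) '' Icc 0 D.Lam)

/-- `x` is an optimal dynamic pricing along the path `P`. -/
def IsOptimalPricing (P : List State) (x : State → ℝ) : Prop :=
  (∀ s, x s ∈ Icc 0 D.Lam) ∧
    ∀ y : State → ℝ, (∀ s, y s ∈ Icc 0 D.Lam) → D.pathValue P y ≤ D.pathValue P x

/-- The policy given by a path and request rates along it. -/
def pathPolicy (P : List State) (x : State → ℝ) : Policy where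
  dispatch := D.pathDispatch P
  rate := pathRate P x

/-! ### The dynamic-programming heuristic -/

/-- An entry of the table: the retained path ending there, and the recorded objective. -/
structure Cell where
  path : List State
  value : ℝ

open Classical in
/-- The entry at `(l + 1, m)`, from the entries `above` at `(l, m)` and `left` at
`(l + 1, m - 1)`. -/
def update (above left : Cell) (l m : ℕ) : Cell :=
  let Pabove := above.path ++ [(l + 1, m)]
  let Pleft := left.path ++ [(l + 1, m)]
  let Rabove := max above.value (D.staticValue Pabove)
  let Rleft := max left.value (D.staticValue Pleft)
  if Rabove < Rleft then ⟨Pleft, Rleft⟩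
  else if Rleft < Rabove then ⟨Pabove, Rabove⟩
  else ⟨if D.Type1 (l, m) then Pabove else Pleft, Rleft⟩

/-- The column `m = 0` of the table, as a function of `l`. -/
def firstColumn : ℕ → Cell
  | 0 => ⟨[(0, 0)], 0⟩
  | l + 1 =>
    let P : List State := (firstColumn l).path ++ [(l + 1, 0)]
    ⟨P, max (firstColumn l).value (D.staticValue P)⟩

/-- The column `m ≥ 1` of the table, from the column before it. -/
def nextColumn (m : ℕ) (prev : ℕ → Cell) : ℕ → Cell
  | 0 => ⟨[(0, m)], 0⟩
  | l + 1 => D.update (nextColumn m prev l) (prev (l + 1)) l m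

/-- The table, column by column: `table m l` is the entry at `(l, m)`. -/
def table : ℕ → ℕ → Cell
  | 0 => D.firstColumn
  | m + 1 => D.nextColumn (m + 1) (table m)

/-- The path returned by the heuristic with queue bound `M`: the one retained at `(L, M)`. -/
def outputPath (M : ℕ) : List State := (D.table M D.L).path

end Model

end SpatialQueue

end

noncomputable section

namespace SpatialQueue

namespace Model

variable (D : Model)

/-! ### Pricing -/

/-! Since `cd = cr`, the reward rate in a state depends only on the request rate and on the level,
the number `l + m` of riders in the system (`reward_eq`). States of one level then differ only
through their service rates, and faster is better. The diminishing-returns conditions carry type 2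
over to larger `m` and to smaller `l`, so on each level the type 2 states are exactly those with
fewer busy drivers than the zigzag state (`DiminishingReturns.type2_iff`). Along a level the service
rate is therefore non-decreasing up to the zigzag path and non-increasing after it, and inside a box
the zigzag path clipped to the box is the fastest path on every level
(`DiminishingReturns.serviceRate_le_clip`).

The table: under a static price, faster service shifts the stationary law of a birth-death chain
down in likelihood ratio, which raises the mean of the decreasing reward (`weighted_mean_le`,
`chainValue_const_mono`). So no competing extension has a larger recorded value than the clipped
zigzag path, ties are broken in its favour, and by induction it fills every cell with `l ≥ 1`
(`isBoxCell_table`).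

Upper bound: in any stationary regime the flow up from a level equals the flow down from the next
one (`IsStationary.cut`). Relative values that depend on the level alone, with decrements `δ ≥ 0`,
hence bound the objective of every policy (`IsStationary.objective_le`). For each `V` above the
value of the path, `exists_bellman` builds `δ` by shooting upwards from level 0; as `δ ≥ 0`, the
inequalities persist for slower states of the same level. Without a queue bound, `δ` is replaced by
`fareMax` from level `M` on, where the waiting cost outweighs total service capacity times the
largest fare.

Attainment: the path up to its first rejecting state is a closed class from which the stationary law
is forced (`IsPathRegime.unique`). For the type rule on the whole state space, `exists_reject` shows
that an optimal pricing rejects before level `M`, so the right wall of the box plays no role. -/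

/-- Revenue rate at effective request rate `x`. -/
def revenue (x : ℝ) : ℝ := x * D.fare x

theorem unitPrice_spec {x : ℝ} (hx : x ∈ Icc 0 D.Lam) :
    D.unitPrice x ∈ Icc 0 D.pMax ∧ D.Lam * (1 - D.F (D.unitPrice x)) = x := by
  have hL := D.Lam_pos
  obtain ⟨p, hp, hFp⟩ := D.F_surj (show 1 - x / D.Lam ∈ Icc (0 : ℝ) 1 from
    ⟨by have := div_le_one_of_le₀ hx.2 hL.le; linarith, by
      have := div_nonneg hx.1 hL.le; linarith⟩)
  have h : ∃ p ∈ Icc 0 D.pMax, (fun p => D.Lam * (1 - D.F p)) p = x :=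
    ⟨p, hp, by simp only [hFp]; field_simp; ring⟩
  exact ⟨Function.invFunOn_mem h, Function.invFunOn_eq h⟩

theorem unitPrice_antitone {x y : ℝ} (hx : x ∈ Icc 0 D.Lam) (hy : y ∈ Icc 0 D.Lam) (hxy : x ≤ y) :
    D.unitPrice y ≤ D.unitPrice x := by
  by_contra! h
  have h1 := D.unitPrice_spec hx
  have h2 := D.unitPrice_spec hy
  have h3 := D.F_strictMono h1.1 h2.1 h
  have := mul_lt_mul_of_pos_left h3 D.Lam_pos
  nlinarith [h1.2, h2.2]

theorem unitPrice_surj {p : ℝ} (hp : p ∈ Icc 0 D.pMax) :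
    ∃ x ∈ Icc 0 D.Lam, D.unitPrice x = p := by
  have h0 : D.F 0 ≤ D.F p :=
    D.F_strictMono.monotoneOn ⟨le_rfl, D.pMax_pos.le⟩ hp hp.1
  have h1 : D.F p ≤ D.F D.pMax :=
    D.F_strictMono.monotoneOn hp ⟨D.pMax_pos.le, le_rfl⟩ hp.2
  rw [D.F_zero] at h0
  rw [D.F_pMax] at h1
  have hL := D.Lam_pos
  have hx : D.Lam * (1 - D.F p) ∈ Icc 0 D.Lam := ⟨by nlinarith, by nlinarith⟩
  refine ⟨_, hx, ?_⟩
  have h2 := D.unitPrice_spec hx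
  refine D.F_strictMono.injOn h2.1 hp ?_
  have := mul_left_cancel₀ hL.ne' h2.2
  linarith

/-- After reflecting the rate, the price becomes a monotone surjection between intervals, which
cannot jump. Continuity is what makes optimal prices exist. -/
theorem unitPrice_continuousOn : ContinuousOn D.unitPrice (Icc 0 D.Lam) := by
  have hrefl : ∀ x : Icc (0 : ℝ) D.Lam, D.Lam - x.1 ∈ Icc 0 D.Lam :=
    fun x => ⟨by linarith [x.2.2], by linarith [x.2.1]⟩
  let f : Icc (0 : ℝ) D.Lam → Icc (0 : ℝ) D.pMax :=
    fun x => ⟨D.unitPrice (D.Lam - x.1), (D.unitPrice_spec (hrefl x)).1⟩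
  have hmono : Monotone f := fun x y hxy =>
    D.unitPrice_antitone (hrefl y) (hrefl x) (by have : x.1 ≤ y.1 := hxy; linarith)
  have hsurj : Function.Surjective f := by
    rintro ⟨p, hp⟩
    obtain ⟨x, hx, hxp⟩ := D.unitPrice_surj hp
    exact ⟨⟨D.Lam - x, hrefl ⟨x, hx⟩⟩, Subtype.ext (by simpa [f] using hxp)⟩
  have hf : Continuous f := hmono.continuous_of_surjective hsurj
  rw [continuousOn_iff_continuous_domRestrict]
  have h2 : Continuous fun x : Icc (0 : ℝ) D.Lam => f ⟨D.Lam - x.1, hrefl x⟩ :=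
    hf.comp (by fun_prop)
  refine (continuous_subtype_val.comp h2).congr fun x => ?_
  simp [f]

theorem fare_continuousOn : ContinuousOn D.fare (Icc 0 D.Lam) := by
  unfold fare
  exact continuousOn_const.add (D.unitPrice_continuousOn.mul continuousOn_const)

theorem fare_nonneg {x : ℝ} (hx : x ∈ Icc 0 D.Lam) : 0 ≤ D.fare x := by
  have := (D.unitPrice_spec hx).1.1
  have h1 := D.p0_nonneg
  have h2 := D.t0_pos
  have h3 := D.wPR_pos
  unfold fare
  positivity

theorem fareMax_pos : 0 < D.fareMax := by
  have h1 := D.p0_nonneg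
  have h2 := D.t0_pos
  have h3 := D.wPR_pos
  have h4 := D.pMax_pos
  unfold fareMax
  positivity

theorem fare_le {x : ℝ} (hx : x ∈ Icc 0 D.Lam) : D.fare x ≤ D.fareMax := by
  have := mul_le_mul_of_nonneg_right (D.unitPrice_spec hx).1.2 D.t0_pos.le
  unfold fare fareMax
  linarith

/-- The top price attracts nobody, as `F pMax = 1`. This strictness is what forces a rejection in
`exists_reject`. -/
theorem fare_lt {x : ℝ} (hx : x ∈ Icc 0 D.Lam) (h0 : 0 < x) : D.fare x < D.fareMax := by
  refine (D.fare_le hx).lt_of_ne fun h => ?_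
  have h1 : D.unitPrice x * D.t0 = D.pMax * D.t0 := by
    unfold fare fareMax at h
    linarith
  have h2 := mul_right_cancel₀ D.t0_pos.ne' h1
  have h3 := (D.unitPrice_spec hx).2
  rw [h2, D.F_pMax] at h3
  linarith

theorem revenue_zero : D.revenue 0 = 0 := by simp [revenue]

theorem revenue_nonneg {x : ℝ} (hx : x ∈ Icc 0 D.Lam) : 0 ≤ D.revenue x :=
  mul_nonneg hx.1 (D.fare_nonneg hx)

theorem revenue_continuousOn : ContinuousOn D.revenue (Icc 0 D.Lam) :=
  continuousOn_id.mul D.fare_continuousOn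

theorem revenue_le {x : ℝ} (hx : x ∈ Icc 0 D.Lam) : D.revenue x ≤ D.Lam * D.fareMax :=
  mul_le_mul hx.2 (D.fare_le hx) (D.fare_nonneg hx) D.Lam_pos.le

theorem cr_pos : 0 < D.cr := D.wQR_pos

/-- The least nonnegative price `y` of a request for which no request rate earns more than `u`. -/
theorem exists_shadow_price {u : ℝ} (hu : 0 < u) :
    ∃ y, 0 ≤ y ∧ y ≤ D.fareMax ∧ (∀ a ∈ Icc 0 D.Lam, D.revenue a - a * y ≤ u) ∧
      ((∃ a ∈ Icc 0 D.Lam, 0 < a ∧ D.revenue a - a * y = u) ∨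
        (y = 0 ∧ ∀ a ∈ Icc 0 D.Lam, D.revenue a ≤ u)) := by
  have hL := D.Lam_pos
  have hM := D.fareMax_pos
  have hq : 0 < D.fareMax + u / D.Lam := by positivity
  -- The shadow price is the positive part of the maximum of `fare a - u / a`. For `a < b` one has
  -- `u / a ≥ fareMax + u / Lam`, so the value there is at most the one at `Lam`; hence the maximum
  -- over all positive rates is attained on the compact `[b, Lam]`.
  set b := min D.Lam (u / (D.fareMax + u / D.Lam)) with hb
  have hb0 : 0 < b := lt_min hL (by positivity)
  have hbL : b ≤ D.Lam := min_le_left _ _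
  have hcont : ContinuousOn (fun a => D.fare a - u / a) (Icc b D.Lam) :=
    (D.fare_continuousOn.mono (Icc_subset_Icc_left hb0.le)).sub
      (continuousOn_const.div continuousOn_id fun a ha => (hb0.trans_le ha.1).ne')
  obtain ⟨x, hx, hmax⟩ := isCompact_Icc.exists_isMaxOn ⟨D.Lam, hbL, le_rfl⟩ hcont
  have hx0 : 0 < x := hb0.trans_le hx.1
  have hxI : x ∈ Icc 0 D.Lam := ⟨hx0.le, hx.2⟩
  have hall : ∀ a ∈ Icc 0 D.Lam, 0 < a → D.fare a - u / a ≤ D.fare x - u / x := by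
    intro a ha ha0
    by_cases hab : b ≤ a
    · exact hmax ⟨hab, ha.2⟩
    · push Not at hab
      have h1 : D.fare D.Lam - u / D.Lam ≤ D.fare x - u / x := hmax ⟨hbL, le_rfl⟩
      have h2 := D.fare_nonneg (x := D.Lam) ⟨hL.le, le_rfl⟩
      have h3 := D.fare_le ha
      have h4 : D.fareMax + u / D.Lam ≤ u / a := by
        rw [le_div_iff₀ ha0]
        have := hab.le.trans (min_le_right _ _)
        rw [le_div_iff₀ hq] at this
        linarith
      linarith
  have key : ∀ y, D.fare x - u / x ≤ y → ∀ a ∈ Icc 0 D.Lam, D.revenue a - a * y ≤ u := by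
    intro y hy a ha
    rcases ha.1.eq_or_lt with h | h
    · subst h
      simpa [revenue] using hu.le
    · have h1 := (hall a ha h).trans hy
      have h2 := mul_le_mul_of_nonneg_left h1 h.le
      have h3 : a * (D.fare a - u / a) = a * D.fare a - u := by field_simp
      unfold revenue
      linarith
  by_cases hy : 0 ≤ D.fare x - u / x
  · refine ⟨_, hy, ?_, key _ le_rfl, Or.inl ⟨x, hxI, hx0, ?_⟩⟩
    · have := D.fare_le hxI
      have : 0 < u / x := by positivity
      linarith
    · unfold revenue
      field_simp
      ring
  · refine ⟨0, le_rfl, hM.le, key _ (not_le.mp hy).le, Or.inr ⟨rfl, fun a ha => ?_⟩⟩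
    simpa using key 0 (not_le.mp hy).le a ha

/-! ### Bounds on service rates. -/

theorem serviceRate_zero (m : ℕ) : D.serviceRate (0, m) = 0 := by simp [serviceRate]

theorem serviceRate_pos {l : ℕ} (m : ℕ) (h0 : 0 < l) (h : l ≤ D.L) :
    0 < D.serviceRate (l, m) := by
  have := D.mu_pos l h m
  have : (0 : ℝ) < l := by exact_mod_cast h0
  unfold serviceRate
  positivity

theorem serviceRate_nonneg {l : ℕ} (m : ℕ) (h : l ≤ D.L) : 0 ≤ D.serviceRate (l, m) := by
  have := D.mu_pos l h m
  unfold serviceRate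
  positivity

theorem muBar_pos : 0 < D.muBar := (D.mu_pos 0 (Nat.zero_le _) 0).trans_le
  (D.mu_le 0 (Nat.zero_le _) 0)

theorem serviceRate_le {l : ℕ} (m : ℕ) (h : l ≤ D.L) : D.serviceRate (l, m) ≤ D.L * D.muBar := by
  unfold serviceRate
  have := D.mu_pos l h m
  exact mul_le_mul (by exact_mod_cast h) (D.mu_le l h m) this.le (by positivity)

end Model

/-! ### Balance between levels -/

/-- The states with `n` riders in the system. -/
def level (n : ℕ) : Finset State := Finset.HasAntidiagonal.antidiagonal n

theorem mem_level {n : ℕ} {s : State} : s ∈ level n ↔ s.1 + s.2 = n :=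
  Finset.HasAntidiagonal.mem_antidiagonal

theorem level_zero : level 0 = {(0, 0)} := rfl

theorem hasSum_levels {f : State → ℝ} {a : ℝ} (h : HasSum f a) :
    HasSum (fun n => ∑ s ∈ level n, f s) a := by
  rw [← Finset.HasAntidiagonal.sigmaAntidiagonalEquivProd.hasSum_iff] at h
  refine h.sigma fun n => ?_
  rw [← Finset.sum_coe_sort]
  exact hasSum_fintype _

/-- A dispatch moves a rider from the queue into service, so only arrivals and completions change
the level. -/
theorem settle_level (φ : State → Bool) (m l : ℕ) :
    (settle φ l m).1 + (settle φ l m).2 = l + m := by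
  induction m generalizing l with
  | zero => simp [settle]
  | succ m ih =>
    unfold settle
    split_ifs
    · rw [ih]; omega
    · rfl

namespace Model

variable (D : Model)

theorem transRate_ne_zero {q : Policy} {s t : State} (h : D.transRate q s t ≠ 0) :
    s.1 + s.2 + 1 = t.1 + t.2 ∨ s.1 + s.2 = t.1 + t.2 + 1 := by
  unfold transRate at h
  by_cases h1 : settle q.dispatch s.1 (s.2 + 1) = t
  · left
    rw [← h1, settle_level]; omega
  · by_cases h2 : settle q.dispatch (s.1 - 1) s.2 = t
    · right
      obtain ⟨l, m⟩ := s
      rcases Nat.eq_zero_or_pos l with h3 | h3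
      · subst h3
        simp [h1, serviceRate_zero] at h
      · rw [← h2, settle_level]
        simp only
        omega
    · simp [h1, h2] at h

theorem transRate_up {q : Policy} {s t : State} (h : s.1 + s.2 + 1 = t.1 + t.2) [Decidable
    (settle q.dispatch s.1 (s.2 + 1) = t)] :
    D.transRate q s t = if settle q.dispatch s.1 (s.2 + 1) = t then q.rate s else 0 := by
  have h2 : settle q.dispatch (s.1 - 1) s.2 ≠ t := by
    intro h2
    have := settle_level q.dispatch s.2 (s.1 - 1)
    rw [h2] at this
    omega
  unfold transRate
  rw [if_neg h2, add_zero]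
  congr

theorem transRate_down {q : Policy} {s t : State} (h : s.1 + s.2 = t.1 + t.2 + 1) [Decidable
    (settle q.dispatch (s.1 - 1) s.2 = t)] :
    D.transRate q s t =
      if settle q.dispatch (s.1 - 1) s.2 = t then D.serviceRate s else 0 := by
  have h2 : settle q.dispatch s.1 (s.2 + 1) ≠ t := by
    intro h2
    have := settle_level q.dispatch (s.2 + 1) s.1
    rw [h2] at this
    omega
  unfold transRate
  rw [if_neg h2, zero_add]
  congr

theorem sum_transRate_up (q : Policy) {s : State} {n : ℕ} (h : s.1 + s.2 + 1 = n) :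
    ∑ t ∈ level n, D.transRate q s t = q.rate s := by
  classical
  rw [Finset.sum_congr rfl fun t ht => D.transRate_up (by rw [mem_level.1 ht, h]),
    Finset.sum_ite_eq, if_pos]
  rw [mem_level, settle_level]
  omega

theorem sum_transRate_down (q : Policy) {s : State} {n : ℕ} (h : s.1 + s.2 = n + 1) :
    ∑ t ∈ level n, D.transRate q s t = D.serviceRate s := by
  classical
  rw [Finset.sum_congr rfl fun t ht => D.transRate_down (by rw [mem_level.1 ht, h]),
    Finset.sum_ite_eq]
  split_ifs with h2
  · rfl
  · rw [mem_level, settle_level] at h2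
    obtain ⟨l, m⟩ := s
    -- Only the truncated `0 - 1` can miss the level, and there the service rate vanishes.
    obtain rfl : l = 0 := by simp only at h h2; omega
    rw [serviceRate_zero]

theorem inflow_zero (q : Policy) (π : State → ℝ) {t : State} (ht : t.1 + t.2 = 0) :
    ∑' s, π s * D.transRate q s t = ∑ s ∈ level 1, π s * D.transRate q s t := by
  refine tsum_eq_sum fun s hs => ?_
  by_contra h
  rcases D.transRate_ne_zero (right_ne_zero_of_mul h) with h1 | h1
  · omega
  · exact hs (mem_level.2 (by omega))

theorem inflow_succ (q : Policy) (π : State → ℝ) {t : State} {n : ℕ} (ht : t.1 + t.2 = n + 1) :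
    ∑' s, π s * D.transRate q s t = ∑ s ∈ level n, π s * D.transRate q s t +
      ∑ s ∈ level (n + 2), π s * D.transRate q s t := by
  rw [← Finset.sum_union]
  · refine tsum_eq_sum fun s hs => ?_
    by_contra h
    rw [Finset.mem_union, mem_level, mem_level] at hs
    rcases D.transRate_ne_zero (right_ne_zero_of_mul h) with h1 | h1 <;> omega
  · rw [Finset.disjoint_left]
    intro s hs hs'
    rw [mem_level] at hs hs'
    omega

/-- In a stationary regime, the flow up from level `n` equals the flow down from level `n + 1`. -/
theorem IsStationary.cut {q : Policy} {π : State → ℝ} (h : D.IsStationary q π) (n : ℕ) :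
    ∑ s ∈ level n, π s * q.rate s =
      ∑ s ∈ level (n + 1), π s * D.serviceRate s := by
  have hout : ∀ n, ∑ t ∈ level n, π t * (q.rate t + D.serviceRate t) =
      ∑ s ∈ level n, π s * q.rate s +
      ∑ s ∈ level n, π s * D.serviceRate s := fun n => by
    rw [← Finset.sum_add_distrib]
    exact Finset.sum_congr rfl fun t _ => mul_add _ _ _
  have hdown : ∀ n, ∑ t ∈ level n, ∑ s ∈ level (n + 1),
      π s * D.transRate q s t = ∑ s ∈ level (n + 1), π s * D.serviceRate s :=
    fun n => by
      rw [Finset.sum_comm]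
      refine Finset.sum_congr rfl fun s hs => ?_
      rw [← Finset.mul_sum, D.sum_transRate_down q (mem_level.1 hs)]
  have hup : ∀ n, ∑ t ∈ level (n + 1), ∑ s ∈ level n,
      π s * D.transRate q s t = ∑ s ∈ level n, π s * q.rate s :=
    fun n => by
      rw [Finset.sum_comm]
      refine Finset.sum_congr rfl fun s hs => ?_
      rw [← Finset.mul_sum, D.sum_transRate_up q (by rw [mem_level.1 hs])]
  -- Balance summed over level `n + 1` equates up-flow plus down-flow out of it with the up-flow
  -- from `n` plus the down-flow from `n + 2`; the induction hypothesis cancels one pair.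
  induction n with
  | zero =>
    have h1 := hout 0
    rw [Finset.sum_congr rfl fun t ht => (h.balance t).trans
      (D.inflow_zero q π (mem_level.1 ht)), hdown 0] at h1
    have h2 : ∑ s ∈ level 0, π s * D.serviceRate s = 0 := by
      simp [level_zero, serviceRate_zero]
    linarith
  | succ n ih =>
    have h1 := hout (n + 1)
    rw [Finset.sum_congr rfl fun t ht => (h.balance t).trans
      (D.inflow_succ q π (mem_level.1 ht)), Finset.sum_add_distrib, hdown (n + 1),
      hup n] at h1
    linarith

/-- A bound on the objective from relative values with bounded increments `δ`. -/
theorem IsStationary.objective_le {q : Policy} {π : State → ℝ} {v V C : ℝ} (hq : D.Admissible q)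
    (h : D.IsStationary q π) (hv : D.HasObjective q π v) (δ : ℕ → ℝ) (hδ : ∀ n, 0 ≤ δ n ∧ δ n ≤ C)
    (hV : ∀ s : State, π s ≠ 0 → D.reward (q.rate s) s - q.rate s * δ (s.1 + s.2 + 1) +
      D.serviceRate s * δ (s.1 + s.2) ≤ V) : v ≤ V := by
  have hC : 0 ≤ C := (hδ 0).1.trans (hδ 0).2
  have hA : Summable fun s => π s * (q.rate s * δ (s.1 + s.2 + 1)) := by
    refine Summable.of_norm_bounded (g := fun s => π s * (D.Lam * C))
      (h.hasSum_one.summable.mul_right _) fun s => ?_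
    by_cases hs : s.1 ≤ D.L
    · have h1 := hq.rate_mem s.1 hs s.2
      have h2 := hδ (s.1 + s.2 + 1)
      have h3 : 0 ≤ q.rate s * δ (s.1 + s.2 + 1) := mul_nonneg h1.1 h2.1
      rw [Real.norm_of_nonneg (mul_nonneg (h.nonneg s) h3)]
      exact mul_le_mul_of_nonneg_left (mul_le_mul h1.2 h2.2 h2.1 D.Lam_pos.le) (h.nonneg s)
    · simp [h.support_states s (not_le.1 hs)]
  have hB : Summable fun s => π s * (D.serviceRate s * δ (s.1 + s.2)) := by
    refine Summable.of_norm_bounded (g := fun s => π s * (D.L * D.muBar * C))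
      (h.hasSum_one.summable.mul_right _) fun s => ?_
    by_cases hs : s.1 ≤ D.L
    · have h0 := D.serviceRate_nonneg s.2 hs
      have h1 := D.serviceRate_le s.2 hs
      have h2 := hδ (s.1 + s.2)
      rw [Real.norm_of_nonneg (mul_nonneg (h.nonneg s) (mul_nonneg h0 h2.1))]
      have := D.muBar_pos
      exact mul_le_mul_of_nonneg_left (mul_le_mul h1 h2.2 h2.1 (by positivity)) (h.nonneg s)
    · simp [h.support_states s (not_le.1 hs)]
  -- As `δ` is constant on levels, the two sums grouped by level agree term by term after a shift by
  -- one, by the cut equation; level 0 has no service. Inserting the `δ` terms thus leaves the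
  -- objective unchanged.
  have hAB : ∑' s, π s * (q.rate s * δ (s.1 + s.2 + 1)) =
      ∑' s, π s * (D.serviceRate s * δ (s.1 + s.2)) := by
    have h1 := hasSum_levels hA.hasSum
    have h2 := hasSum_levels hB.hasSum
    rw [← hasSum_nat_add_iff' 1] at h2
    have h3 : ∀ n, ∑ s ∈ level n, π s * (q.rate s * δ (s.1 + s.2 + 1)) =
        ∑ s ∈ level (n + 1), π s * (D.serviceRate s * δ (s.1 + s.2)) := fun n => by
      have e1 : ∀ s ∈ level n, π s * (q.rate s * δ (s.1 + s.2 + 1)) =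
          π s * q.rate s * δ (n + 1) := fun s hs => by
        rw [mem_level.1 hs]; ring
      have e2 : ∀ s ∈ level (n + 1), π s * (D.serviceRate s * δ (s.1 + s.2)) =
          π s * D.serviceRate s * δ (n + 1) := fun s hs => by
        rw [mem_level.1 hs]; ring
      rw [Finset.sum_congr rfl e1, Finset.sum_congr rfl e2, ← Finset.sum_mul, ← Finset.sum_mul,
        h.cut]
    rw [Finset.sum_range_one, level_zero, Finset.sum_singleton, serviceRate_zero, zero_mul,
      mul_zero, sub_zero] at h2
    simp only [h3] at h1
    exact h1.unique h2
  have hsum := (HasSum.sub hv hA.hasSum).add hB.hasSum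
  rw [hAB, sub_add_cancel] at hsum
  have hVs := h.hasSum_one.mul_right V
  rw [one_mul] at hVs
  refine hasSum_le (fun s => ?_) hsum hVs
  by_cases hs : π s = 0
  · simp [hs]
  · have := mul_le_mul_of_nonneg_left (hV s hs) (h.nonneg s)
    linarith

end Model

namespace Model

variable (D : Model)

/-! ### Types of states and the zigzag path -/

theorem type1_iff_not_type2 {l m : ℕ} (hl : l ≤ D.L) : D.Type1 (l, m) ↔ ¬ D.Type2 (l, m) := by
  unfold Type1 Type2
  simp only [not_and, not_le]
  constructor
  · rintro (h | h | h) h1 h2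
    · omega
    · contradiction
    · exact h
  · intro h
    by_cases h1 : l = D.L
    · exact Or.inl h1
    · by_cases h2 : m = 0
      · exact Or.inr (Or.inl h2)
      · exact Or.inr (Or.inr (h (by omega) h2))

theorem typeRule_eq_true {s : State} : D.typeRule s = true ↔ D.Type2 s := by
  simp [typeRule]

variable {D}

/-- Condition 1: the gain in service rate from one more waiting rider at `(l, m)` is at most the
previous gain in row `l`, hence at most the gain at `(l + 1, m - 1)`. -/
theorem DiminishingReturns.type2_succ_right (hD : D.DiminishingReturns) {l m : ℕ}
    (h : D.Type2 (l, m)) : D.Type2 (l, m + 1) := by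
  obtain ⟨h1, h2, h3⟩ := h
  simp only at h1 h2 h3
  obtain ⟨k, rfl⟩ := Nat.exists_eq_succ_of_ne_zero h2
  refine ⟨h1, by simp, ?_⟩
  have e1 := hD.incr_m_anti_m l h1.le (Nat.le_succ k)
  have e2 := hD.incr_m_mono_l k (mem_Iic.2 h1.le) (mem_Iic.2 h1) (Nat.le_succ l)
  simp only [Nat.succ_eq_add_one, Nat.add_sub_cancel] at *
  linarith

/-- Condition 2: the gain from one more busy driver shrinks with `l` and grows with `m`, so a
dispatch that pays off in row `l + 1` pays off in row `l`. -/
theorem DiminishingReturns.type2_of_succ_left (hD : D.DiminishingReturns) {l m : ℕ}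
    (h : D.Type2 (l + 1, m)) : D.Type2 (l, m) := by
  obtain ⟨h1, h2, h3⟩ := h
  simp only at h1 h2 h3
  obtain ⟨k, rfl⟩ := Nat.exists_eq_succ_of_ne_zero h2
  have h4 : l < D.L := by omega
  refine ⟨h4, by simp, ?_⟩
  have e1 := hD.incr_l_anti_l k (mem_Iio.2 h4) (mem_Iio.2 h1) (Nat.le_succ l)
  have e2 := hD.incr_l_mono_m l h4 (Nat.le_succ k)
  simp only [Nat.succ_eq_add_one, Nat.add_sub_cancel] at *
  linarith

variable (D)

/-- The number of busy drivers in the `n`-th state of the zigzag path. -/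
def busy (n : ℕ) : ℕ := (zigzag D.typeRule n).1

theorem zigzag_level (φ : State → Bool) (n : ℕ) : (zigzag φ n).1 + (zigzag φ n).2 = n := by
  induction n with
  | zero => rfl
  | succ n ih =>
    simp only [zigzag]
    split_ifs <;> simp only <;> omega

theorem busy_le (n : ℕ) : D.busy n ≤ n := by
  have := zigzag_level D.typeRule n
  unfold busy
  omega

theorem zigzag_eq (n : ℕ) : zigzag D.typeRule n = (D.busy n, n - D.busy n) := by
  have := zigzag_level D.typeRule n
  unfold busy
  exact Prod.ext rfl (by simp only; omega)

theorem busy_zero : D.busy 0 = 0 := rfl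

open Classical in
theorem busy_succ (n : ℕ) : D.busy (n + 1) =
    if D.Type2 (D.busy n, n + 1 - D.busy n) then D.busy n + 1 else D.busy n := by
  have h := D.zigzag_eq n
  have h2 := D.busy_le n
  have h3 : n - D.busy n + 1 = n + 1 - D.busy n := by omega
  conv_lhs => rw [busy, zigzag, h]
  simp only [h3, D.typeRule_eq_true]
  split_ifs <;> rfl

theorem busy_le_L (n : ℕ) : D.busy n ≤ D.L := by
  induction n with
  | zero => simp [busy_zero]
  | succ n ih =>
    rw [busy_succ]
    split_ifs with h
    · exact h.1
    · exact ih

theorem busy_mono : Monotone D.busy := by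
  refine monotone_nat_of_le_succ fun n => ?_
  rw [busy_succ]
  split_ifs <;> omega

theorem busy_add_le (n k : ℕ) : D.busy (n + k) ≤ D.busy n + k := by
  induction k with
  | zero => simp
  | succ k ih =>
    rw [← add_assoc, busy_succ]
    split_ifs <;> omega

theorem busy_succ_le (n : ℕ) : D.busy (n + 1) ≤ D.busy n + 1 := D.busy_add_le n 1

/-- An idle fleet serves nobody, so the first rider is dispatched at once. The path leaves row 0
immediately, which keeps its service rates positive from level 1 on. -/
theorem busy_one : D.busy 1 = 1 := by
  rw [busy_succ, busy_zero, if_pos]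
  refine ⟨D.one_le_L, by simp, ?_⟩
  rw [serviceRate_zero]
  exact D.serviceRate_nonneg _ D.one_le_L

theorem one_le_busy {n : ℕ} (hn : 1 ≤ n) : 1 ≤ D.busy n := by
  have := D.busy_mono hn
  rwa [busy_one] at this

variable {D}

/-- On every level, the zigzag path separates the type 2 states from the type 1 states. -/
theorem DiminishingReturns.type2_iff (hD : D.DiminishingReturns) {l m : ℕ} :
    D.Type2 (l, m) ↔ l < D.busy (l + m) := by
  have key : ∀ n l m, l + m = n → (D.Type2 (l, m) ↔ l < D.busy n) := by
    intro n
    induction n with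
    | zero =>
      intro l m h
      obtain rfl : m = 0 := by omega
      simp [Type2, busy_zero]
    | succ n ih =>
      have hmono : ∀ k l m, D.Type2 (l + k, m) → D.Type2 (l, m) := by
        intro k
        induction k with
        | zero => exact fun _ _ h => h
        | succ k ihk => exact fun l m h => ihk l m (hD.type2_of_succ_left h)
      have hup : ∀ j m, D.Type2 (D.busy n, m) → D.Type2 (D.busy n, m + j) := by
        intro j
        induction j with
        | zero => exact fun _ h => h
        | succ j ihj => exact fun m h => hD.type2_succ_right (ihj m h)
      intro l m h
      have hb := D.busy_le n
      rw [busy_succ]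
      constructor
      · intro h2
        -- A type 2 state on the wrong side of the path is carried by `hmono` to row `busy n` and
        -- then right by `hup`, to the zigzag state of level `n` or to its right neighbour; neither
        -- is of type 2 in the respective case.
        by_contra hlt
        split_ifs at hlt with h3
        · obtain ⟨k, rfl⟩ : ∃ k, l = D.busy n + 1 + k := ⟨l - (D.busy n + 1), by omega⟩
          have h4 := hmono k _ _ h2
          have hm : m ≠ 0 := h2.2.1
          have h5 : ¬ D.Type2 (D.busy n, n - D.busy n) := by
            rw [ih _ _ (by omega)]; omega
          have h6 : D.Type2 (D.busy n, m) := hmono 1 _ _ h4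
          refine h5 ?_
          have := hup k m h6
          rwa [show m + k = n - D.busy n by omega] at this
        · obtain ⟨k, rfl⟩ : ∃ k, l = D.busy n + k := ⟨l - D.busy n, by omega⟩
          have h6 : D.Type2 (D.busy n, m) := hmono k _ _ h2
          refine h3 ?_
          have := hup k m h6
          rwa [show m + k = n + 1 - D.busy n by omega] at this
      · intro hlt
        by_cases h3 : l < D.busy n
        · obtain ⟨k, rfl⟩ : ∃ k, m = k + 1 := ⟨m - 1, by omega⟩
          exact hD.type2_succ_right ((ih l k (by omega)).2 h3)
        · split_ifs at hlt with h4
          · obtain rfl : l = D.busy n := by omega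
            rwa [show n + 1 - D.busy n = m by omega] at h4
          · omega
  exact key _ l m rfl

theorem DiminishingReturns.type1_iff (hD : D.DiminishingReturns) {l m : ℕ} (hl : l ≤ D.L) :
    D.Type1 (l, m) ↔ D.busy (l + m) ≤ l := by
  rw [D.type1_iff_not_type2 hl, hD.type2_iff, not_lt]

/-- All states passed on the way to the path are of type 2, and by definition a dispatch from such a
state does not lower the rate. -/
theorem DiminishingReturns.serviceRate_le_of_le_busy (hD : D.DiminishingReturns) {n k : ℕ} :
    ∀ l, l + k ≤ D.busy n → D.serviceRate (l, n - l) ≤ D.serviceRate (l + k, n - (l + k)) := by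
  induction k with
  | zero => exact fun _ _ => le_rfl
  | succ k ih =>
    intro l h
    have hb := D.busy_le n
    have h1 : D.Type2 (l + k, n - (l + k)) := by
      rw [hD.type2_iff, show l + k + (n - (l + k)) = n by omega]; omega
    exact (ih l (by omega)).trans (h1.2.2.trans_eq rfl)

theorem DiminishingReturns.serviceRate_le_of_busy_le (hD : D.DiminishingReturns) {n k : ℕ} :
    ∀ l, D.busy n ≤ l → l + k ≤ n → l + k ≤ D.L →
      D.serviceRate (l + k, n - (l + k)) ≤ D.serviceRate (l, n - l) := by
  induction k with
  | zero => exact fun _ _ _ _ => le_rfl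
  | succ k ih =>
    intro l h h2 h3
    have h1 : D.Type1 (l + k, n - (l + k)) := by
      rw [hD.type1_iff (by omega), show l + k + (n - (l + k)) = n by omega]; omega
    refine le_trans ?_ (ih l h (by omega) (by omega))
    rcases h1 with h1 | h1 | h1
    · simp only at h1; omega
    · simp only at h1; omega
    · refine le_trans (le_of_eq ?_) h1.le
      rfl

/-! ### The zigzag path, clipped to a box -/

variable (D)

/-- Busy drivers in the state of level `i` nearest to the zigzag path in `[0, a] × [0, b]`. -/
def clipBusy (a b i : ℕ) : ℕ := max (i - b) (min a (D.busy i))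

/-- The state of level `i` nearest to the zigzag path in the box `[0, a] × [0, b]`. -/
def clip (a b i : ℕ) : State := (D.clipBusy a b i, i - D.clipBusy a b i)

/-- The zigzag path, clipped to the box `[0, a] × [0, b]`. -/
def boxPath (a b : ℕ) : List State := (List.range (a + b + 1)).map (D.clip a b)

theorem clip_level (a b i : ℕ) : (D.clip a b i).1 + (D.clip a b i).2 = i := by
  have := D.busy_le i
  simp only [clip, clipBusy]
  omega

theorem clip_fst_le {a b i : ℕ} (h : i ≤ a + b) : (D.clip a b i).1 ≤ a := by
  simp only [clip, clipBusy]
  omega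

theorem clip_snd_le (a b i : ℕ) : (D.clip a b i).2 ≤ b := by
  simp only [clip, clipBusy]
  omega

theorem clip_zero (a b : ℕ) : D.clip a b 0 = (0, 0) := by
  simp [clip, clipBusy, busy_zero]

theorem one_le_clip_fst {a b i : ℕ} (ha : 1 ≤ a) (hi : 1 ≤ i) : 1 ≤ (D.clip a b i).1 := by
  have := D.one_le_busy hi
  simp only [clip, clipBusy]
  omega

theorem clip_last {a b i : ℕ} (h : i = a + b) : D.clip a b i = (a, b) := by
  have h1 : D.clipBusy a b i = a := by unfold clipBusy; omega
  rw [clip, h1, h]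
  simp

theorem clip_eq_zigzag {a b i : ℕ} (h1 : D.busy i ≤ a) (h2 : i - D.busy i ≤ b) :
    D.clip a b i = zigzag D.typeRule i := by
  have h : D.clipBusy a b i = D.busy i := by unfold clipBusy; omega
  rw [clip, h, zigzag_eq]

theorem boxPath_length (a b : ℕ) : (D.boxPath a b).length = a + b + 1 := by simp [boxPath]

theorem boxPath_getElem? {a b i : ℕ} (h : i ≤ a + b) :
    (D.boxPath a b)[i]? = some (D.clip a b i) := by
  rw [boxPath, List.getElem?_map, List.getElem?_range (by omega), Option.map_some]

theorem nth_boxPath {a b i : ℕ} (h : i ≤ a + b) : nth (D.boxPath a b) i = D.clip a b i := by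
  rw [nth, List.getD_eq_getElem?_getD, boxPath_getElem? D h, Option.getD_some]

theorem mem_boxPath {a b : ℕ} {s : State} :
    s ∈ D.boxPath a b ↔ s.1 + s.2 ≤ a + b ∧ s = D.clip a b (s.1 + s.2) := by
  simp only [boxPath, List.mem_map, List.mem_range]
  constructor
  · rintro ⟨i, hi, rfl⟩
    rw [clip_level]
    exact ⟨by omega, rfl⟩
  · rintro ⟨h, h2⟩
    exact ⟨_, by omega, h2.symm⟩

variable {D}

/-- In the box, the service rate on a level is largest on the clipped zigzag path. -/
theorem DiminishingReturns.serviceRate_le_clip (hD : D.DiminishingReturns) {a b l m : ℕ}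
    (ha : a ≤ D.L) (hl : l ≤ a) (hm : m ≤ b) :
    D.serviceRate (l, m) ≤ D.serviceRate (D.clip a b (l + m)) := by
  obtain ⟨n, hn⟩ : ∃ n, n = l + m := ⟨_, rfl⟩
  have hb := D.busy_le n
  rw [← hn, show (l, m) = (l, n - l) by rw [hn]; simp]
  unfold clip
  obtain ⟨c, hc⟩ : ∃ c, c = D.clipBusy a b n := ⟨_, rfl⟩
  rw [← hc]
  unfold clipBusy at hc
  rcases le_total l c with h | h
  · obtain ⟨k, rfl⟩ : ∃ k, c = l + k := ⟨c - l, by omega⟩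
    by_cases h0 : k = 0
    · subst h0; exact le_rfl
    · exact hD.serviceRate_le_of_le_busy l (by omega)
  · obtain ⟨k, rfl⟩ : ∃ k, l = c + k := ⟨l - c, by omega⟩
    by_cases h0 : k = 0
    · subst h0; exact le_rfl
    · exact hD.serviceRate_le_of_busy_le c (by omega) (by omega) (by omega)

/-- The path gains at most one busy driver per level, so being below `(l, m + 1)` on that level it
has at most `m` waiting riders earlier. It enters the corner from the left. -/
theorem clip_of_type2 (hD : D.DiminishingReturns) {l m i : ℕ} (h : D.Type2 (l, m + 1))
    (hi : i ≤ l + 1 + m) : D.clip (l + 1) (m + 1) i = D.clip (l + 1) m i := by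
  rw [hD.type2_iff] at h
  have h1 := D.busy_add_le i (l + 1 + m - i)
  rw [show i + (l + 1 + m - i) = l + (m + 1) by omega] at h1
  have : D.clipBusy (l + 1) (m + 1) i = D.clipBusy (l + 1) m i := by unfold clipBusy; omega
  rw [clip, clip, this]

/-- The path has at most `l` busy drivers up to this level, so the row bound `l + 1` never binds. It
enters the corner from above. -/
theorem clip_of_type1 (hD : D.DiminishingReturns) {l m i : ℕ} (hl : l ≤ D.L)
    (h : D.Type1 (l, m + 1)) (hi : i ≤ l + (m + 1)) :
    D.clip (l + 1) (m + 1) i = D.clip l (m + 1) i := by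
  rw [hD.type1_iff hl] at h
  have h1 := D.busy_mono hi
  have : D.clipBusy (l + 1) (m + 1) i = D.clipBusy l (m + 1) i := by unfold clipBusy; omega
  rw [clip, clip, this]

theorem clip_first_column {l i : ℕ} (hi : i ≤ l) : D.clip l 0 i = (i, 0) := by
  have : D.clipBusy l 0 i = i := by
    have := D.busy_le i
    unfold clipBusy; omega
  rw [clip, this]
  simp

end Model

/-! ### Birth-death chains -/

/-- Weighted means of a decreasing function decrease in the likelihood-ratio order. -/
theorem weighted_mean_le {n : ℕ} {w w' f : ℕ → ℝ} (hw : 0 < ∑ i ∈ Finset.range n, w i)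
    (hw' : 0 < ∑ i ∈ Finset.range n, w' i)
    (h : ∀ i k, i < k → k < n → w' i * w k ≤ w i * w' k)
    (hf : ∀ i k, i < k → k < n → f k ≤ f i) :
    (∑ i ∈ Finset.range n, w' i * f i) / ∑ i ∈ Finset.range n, w' i ≤
      (∑ i ∈ Finset.range n, w i * f i) / ∑ i ∈ Finset.range n, w i := by
  rw [div_le_div_iff₀ hw' hw]
  -- Chebyshev symmetrisation: the two factors of each term have the same sign.
  have h1 : 0 ≤ ∑ i ∈ Finset.range n, ∑ k ∈ Finset.range n,
      (w i * w' k - w k * w' i) * (f i - f k) := by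
    refine Finset.sum_nonneg fun i hi => Finset.sum_nonneg fun k hk => ?_
    rw [Finset.mem_range] at hi hk
    rcases lt_trichotomy i k with hik | rfl | hik
    · exact mul_nonneg (by linarith [h i k hik hk]) (by linarith [hf i k hik hk])
    · simp
    · exact mul_nonneg_of_nonpos_of_nonpos (by linarith [h k i hik hi]) (by linarith [hf k i hik hi])
  have h2 : ∑ i ∈ Finset.range n, ∑ k ∈ Finset.range n,
      (w i * w' k - w k * w' i) * (f i - f k) =
      2 * ((∑ i ∈ Finset.range n, w i * f i) * (∑ i ∈ Finset.range n, w' i) -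
        (∑ i ∈ Finset.range n, w' i * f i) * ∑ i ∈ Finset.range n, w i) := by
    have e : ∀ u v : ℕ → ℝ, (∑ i ∈ Finset.range n, u i) * (∑ i ∈ Finset.range n, v i) =
        ∑ i ∈ Finset.range n, ∑ k ∈ Finset.range n, u i * v k := fun u v => by
      rw [Finset.sum_mul_sum]
    have e2 : ∀ u v : ℕ → ℝ, (∑ i ∈ Finset.range n, u i) * (∑ i ∈ Finset.range n, v i) =
        ∑ i ∈ Finset.range n, ∑ k ∈ Finset.range n, u k * v i := fun u v => by
      rw [e, Finset.sum_comm]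
    have : 2 * ((∑ i ∈ Finset.range n, w i * f i) * (∑ i ∈ Finset.range n, w' i) -
        (∑ i ∈ Finset.range n, w' i * f i) * ∑ i ∈ Finset.range n, w i) =
        (∑ i ∈ Finset.range n, w i * f i) * (∑ i ∈ Finset.range n, w' i) +
        (∑ i ∈ Finset.range n, w i * f i) * (∑ i ∈ Finset.range n, w' i) -
        (∑ i ∈ Finset.range n, w' i * f i) * (∑ i ∈ Finset.range n, w i) -
        (∑ i ∈ Finset.range n, w' i * f i) * (∑ i ∈ Finset.range n, w i) := by ring
    rw [this]
    nth_rewrite 1 [e]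
    rw [e2 (fun i => w i * f i)]
    nth_rewrite 1 [e (fun i => w' i * f i)]
    rw [e2 (fun i => w' i * f i)]
    simp only [← Finset.sum_add_distrib, ← Finset.sum_sub_distrib]
    exact Finset.sum_congr rfl fun i _ => Finset.sum_congr rfl fun k _ => by ring
  linarith

/-- Unnormalised stationary weights of a birth-death chain with birth rates `x` and death
rates `ρ`. -/
def chainWeight (ρ x : ℕ → ℝ) (i : ℕ) : ℝ := ∏ j ∈ Finset.range i, x j / ρ (j + 1)

theorem chainWeight_zero (ρ x : ℕ → ℝ) : chainWeight ρ x 0 = 1 := by simp [chainWeight]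

theorem chainWeight_succ {ρ x : ℕ → ℝ} {i : ℕ} (h : 0 < ρ (i + 1)) :
    chainWeight ρ x (i + 1) * ρ (i + 1) = chainWeight ρ x i * x i := by
  rw [chainWeight, Finset.prod_range_succ, ← chainWeight]
  field_simp

theorem chainWeight_nonneg {ρ x : ℕ → ℝ} {n : ℕ} (hρ : ∀ i, 1 ≤ i → i ≤ n → 0 < ρ i)
    (hx : ∀ i < n, 0 ≤ x i) {i : ℕ} (hi : i ≤ n) : 0 ≤ chainWeight ρ x i :=
  Finset.prod_nonneg fun j hj => by
    have := Finset.mem_range.1 hj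
    exact div_nonneg (hx j (by omega)) (hρ (j + 1) (by omega) (by omega)).le

theorem chainWeight_pos {ρ x : ℕ → ℝ} {n : ℕ} (hρ : ∀ i, 1 ≤ i → i ≤ n → 0 < ρ i)
    (hx : ∀ i < n, 0 < x i) {i : ℕ} (hi : i ≤ n) : 0 < chainWeight ρ x i :=
  Finset.prod_pos fun j hj => by
    have := Finset.mem_range.1 hj
    exact div_pos (hx j (by omega)) (hρ (j + 1) (by omega) (by omega))

theorem chainWeight_eq_zero {ρ x : ℕ → ℝ} {i j : ℕ} (hj : x j = 0) (h : j < i) :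
    chainWeight ρ x i = 0 :=
  Finset.prod_eq_zero (Finset.mem_range.2 h) (by rw [hj, zero_div])

theorem chainWeight_congr {ρ ρ' x x' : ℕ → ℝ} {n i : ℕ} (hρ : ∀ i, 1 ≤ i → i ≤ n → ρ i = ρ' i)
    (hx : ∀ i < n, x i = x' i) (hi : i ≤ n) : chainWeight ρ x i = chainWeight ρ' x' i :=
  Finset.prod_congr rfl fun j hj => by
    have := Finset.mem_range.1 hj
    rw [hx j (by omega), hρ (j + 1) (by omega) (by omega)]

theorem sum_chainWeight_pos {ρ x : ℕ → ℝ} {n : ℕ} (hρ : ∀ i, 1 ≤ i → i ≤ n → 0 < ρ i)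
    (hx : ∀ i < n, 0 ≤ x i) : 0 < ∑ i ∈ Finset.range (n + 1), chainWeight ρ x i := by
  refine Finset.sum_pos' (fun i hi => chainWeight_nonneg hρ hx (by
    have := Finset.mem_range.1 hi; omega)) ⟨0, by simp, ?_⟩
  rw [chainWeight_zero]
  exact one_pos

namespace Model

variable (D : Model)

/-- Reward rate in state `i` of a birth-death chain on `{0, …, n}` with birth rates `x`, where `i`
is the number of riders in the system. -/
def chainReward (x : ℕ → ℝ) (n i : ℕ) : ℝ := (if i < n then D.revenue (x i) else 0) - D.cr * i

/-- Long-run average reward of the birth-death chain on `{0, …, n}`. -/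
def chainValue (ρ x : ℕ → ℝ) (n : ℕ) : ℝ :=
  (∑ i ∈ Finset.range (n + 1), chainWeight ρ x i * D.chainReward x n i) /
    ∑ i ∈ Finset.range (n + 1), chainWeight ρ x i

theorem chainReward_congr {x x' : ℕ → ℝ} {n : ℕ} (hx : ∀ i < n, x i = x' i) (i : ℕ) :
    D.chainReward x n i = D.chainReward x' n i := by
  unfold chainReward
  split_ifs with h
  · rw [hx i h]
  · rfl

theorem chainValue_congr {ρ ρ' x x' : ℕ → ℝ} {n : ℕ} (hρ : ∀ i, 1 ≤ i → i ≤ n → ρ i = ρ' i)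
    (hx : ∀ i < n, x i = x' i) : D.chainValue ρ x n = D.chainValue ρ' x' n := by
  have h : ∀ i ∈ Finset.range (n + 1), chainWeight ρ x i = chainWeight ρ' x' i := fun i hi =>
    chainWeight_congr hρ hx (by have := Finset.mem_range.1 hi; omega)
  unfold chainValue
  rw [Finset.sum_congr rfl h, Finset.sum_congr rfl fun i hi => by
    rw [h i hi, D.chainReward_congr hx]]

/-- A chain that rejects in state `j` lives on `{0, …, j}`. -/
theorem chainValue_eq_of_zero {ρ x : ℕ → ℝ} {n j : ℕ} (hj : j ≤ n) (h : j < n → x j = 0) :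
    D.chainValue ρ x n = D.chainValue ρ x j := by
  rcases hj.eq_or_lt with rfl | hj
  · rfl
  have h0 := h hj
  have hsub : Finset.range (j + 1) ⊆ Finset.range (n + 1) :=
    Finset.range_subset_range.2 (by omega)
  have hz : ∀ i ∈ Finset.range (n + 1), i ∉ Finset.range (j + 1) → chainWeight ρ x i = 0 :=
    fun i _ hi => chainWeight_eq_zero h0 (by rw [Finset.mem_range] at hi; omega)
  unfold chainValue
  rw [← Finset.sum_subset hsub hz, ← Finset.sum_subset hsub fun i hi hi' => by
    rw [hz i hi hi', zero_mul]]
  congr 1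
  refine Finset.sum_congr rfl fun i hi => ?_
  rw [Finset.mem_range] at hi
  unfold chainReward
  rcases (show i ≤ j by omega).eq_or_lt with rfl | hij
  · rw [if_pos hj, if_neg (lt_irrefl _), h0, revenue_zero]
  · rw [if_pos hij, if_pos (hij.trans hj)]

theorem chainValue_le {ρ x : ℕ → ℝ} {n : ℕ} (hρ : ∀ i, 1 ≤ i → i ≤ n → 0 < ρ i)
    (hx : ∀ i < n, x i ∈ Icc 0 D.Lam) : D.chainValue ρ x n ≤ D.Lam * D.fareMax := by
  have hx' : ∀ i < n, 0 ≤ x i := fun i hi => (hx i hi).1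
  rw [chainValue, div_le_iff₀ (sum_chainWeight_pos hρ hx'), Finset.mul_sum]
  refine Finset.sum_le_sum fun i hi => ?_
  rw [mul_comm]
  have h0 : 0 ≤ D.cr * i := mul_nonneg D.cr_pos.le (Nat.cast_nonneg _)
  refine mul_le_mul_of_nonneg_right ?_ (chainWeight_nonneg hρ hx' (by
    have := Finset.mem_range.1 hi; omega))
  unfold chainReward
  split_ifs with h
  · linarith [D.revenue_le (hx i h)]
  · have := mul_pos D.Lam_pos D.fareMax_pos
    linarith

theorem chainReward_const_antitone {a : ℝ} (ha : a ∈ Icc 0 D.Lam) {n i k : ℕ} (h : i < k) :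
    D.chainReward (fun _ => a) n k ≤ D.chainReward (fun _ => a) n i := by
  have h0 := D.revenue_nonneg ha
  have h1 : D.cr * i ≤ D.cr * k :=
    mul_le_mul_of_nonneg_left (by exact_mod_cast h.le) D.cr_pos.le
  unfold chainReward
  split_ifs with h2 h3
  · linarith
  · omega
  · linarith
  · linarith

/-! ### Comparison of static values. -/

/-- Under static pricing, faster service is better. -/
theorem chainValue_const_mono {ρ ρ' : ℕ → ℝ} {n : ℕ} (hρ : ∀ i, 1 ≤ i → i ≤ n → 0 < ρ' i)
    (hle : ∀ i, 1 ≤ i → i ≤ n → ρ' i ≤ ρ i) {a : ℝ} (ha : a ∈ Icc 0 D.Lam) :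
    D.chainValue ρ' (fun _ => a) n ≤ D.chainValue ρ (fun _ => a) n := by
  have hρ2 : ∀ i, 1 ≤ i → i ≤ n → 0 < ρ i := fun i h1 h2 => (hρ i h1 h2).trans_le (hle i h1 h2)
  have ha' : ∀ i < n, 0 ≤ (fun _ : ℕ => a) i := fun _ _ => ha.1
  refine weighted_mean_le (sum_chainWeight_pos hρ2 ha') (sum_chainWeight_pos hρ ha')
    (fun i k hik hk => ?_) fun i k hik _ => D.chainReward_const_antitone ha hik
  -- The likelihood ratio of `k` against `i` is the product over the steps between them, and each
  -- factor decreases in the death rate.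
  have e : ∀ ρ : ℕ → ℝ, chainWeight ρ (fun _ => a) k =
      chainWeight ρ (fun _ => a) i * ∏ j ∈ Finset.Ico i k, a / ρ (j + 1) := fun ρ =>
    (Finset.prod_range_mul_prod_Ico _ hik.le).symm
  rw [e ρ, e ρ']
  have h1 := chainWeight_nonneg hρ2 ha' (i := i) (by omega)
  have h2 := chainWeight_nonneg hρ ha' (i := i) (by omega)
  have h3 : ∏ j ∈ Finset.Ico i k, a / ρ (j + 1) ≤ ∏ j ∈ Finset.Ico i k, a / ρ' (j + 1) := by
    refine Finset.prod_le_prod (fun j hj => ?_) fun j hj => ?_ <;> rw [Finset.mem_Ico] at hj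
    · exact div_nonneg ha.1 (hρ2 (j + 1) (by omega) (by omega)).le
    · exact div_le_div_of_nonneg_left ha.1 (hρ (j + 1) (by omega) (by omega))
        (hle (j + 1) (by omega) (by omega))
  have h4 := mul_le_mul_of_nonneg_left h3 (mul_nonneg h2 h1)
  linarith

/-- Under static pricing, removing all states of a chain but the last two is not an improvement. -/
theorem chainValue_last_two_le {ρ : ℕ → ℝ} {n : ℕ} {b : ℝ} (hb : 0 < b)
    (hρ : ∀ i, 1 ≤ i → i ≤ n + 1 → 0 < ρ i) (hlast : ρ (n + 1) = b) {a : ℝ}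
    (ha : a ∈ Icc 0 D.Lam) :
    D.chainValue (fun _ => b) (fun _ => a) 1 - D.cr * n ≤ D.chainValue ρ (fun _ => a) (n + 1) := by
  have ha' : ∀ i < n + 1, 0 ≤ (fun _ : ℕ => a) i := fun _ _ => ha.1
  have hab : 0 ≤ a / b := div_nonneg ha.1 hb.le
  -- The two-state chain moved up by `n` levels, as weights on `{0, …, n + 1}`. Its ratio on the
  -- last two states is that of the full chain, so it dominates in likelihood ratio.
  obtain ⟨w', hw'⟩ : ∃ w' : ℕ → ℝ, w' = fun i => if i < n then 0 else if i = n then 1 else a / b :=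
    ⟨_, rfl⟩
  have hlow : ∀ i < n, w' i = 0 := fun i hi => by simp [hw', hi]
  have hn : w' n = 1 := by simp [hw']
  have hn1 : w' (n + 1) = a / b := by simp [hw']
  have hsum : ∀ f : ℕ → ℝ, ∑ i ∈ Finset.range (n + 1 + 1), w' i * f i =
      f n + a / b * f (n + 1) := fun f => by
    rw [Finset.sum_range_succ, Finset.sum_range_succ, Finset.sum_eq_zero, hn, hn1]
    · ring
    · intro i hi
      rw [hlow i (Finset.mem_range.1 hi), zero_mul]
  have hsum1 : ∑ i ∈ Finset.range (n + 1 + 1), w' i = 1 + a / b := by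
    simpa using hsum fun _ => 1
  have key := weighted_mean_le (n := n + 1 + 1) (w := chainWeight ρ fun _ => a) (w' := w')
    (f := D.chainReward (fun _ => a) (n + 1)) (sum_chainWeight_pos hρ ha')
    (by rw [hsum1]; positivity) (fun i k hik hk => ?_)
    fun i k hik _ => D.chainReward_const_antitone ha hik
  · refine le_trans (le_of_eq ?_) key
    rw [hsum, hsum1]
    unfold chainValue chainReward chainWeight
    have : 0 < 1 + a / b := by positivity
    simp only [Finset.sum_range_succ, Finset.range_zero, Finset.sum_empty, Finset.prod_empty,
      Finset.prod_range_succ, zero_add, one_mul, zero_lt_one, if_true, lt_irrefl, if_false,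
      Nat.lt_succ_self, Nat.cast_zero, mul_zero, sub_zero, Nat.cast_one, mul_one, Nat.cast_add]
    rw [eq_div_iff this.ne', sub_mul, div_mul_cancel₀ _ this.ne']
    ring
  · have hnn : ∀ i ≤ n + 1, 0 ≤ chainWeight ρ (fun _ => a) i := fun i hi =>
      chainWeight_nonneg hρ ha' hi
    by_cases hi : i < n
    · rw [hlow i hi, zero_mul]
      have : 0 ≤ w' k := by rw [hw']; simp only; split_ifs <;> simp [hab]
      exact mul_nonneg (hnn i (by omega)) this
    · obtain rfl : i = n := by omega
      obtain rfl : k = i + 1 := by omega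
      rw [hn, hn1, one_mul, chainWeight, Finset.prod_range_succ, ← chainWeight, hlast]

/-- The best static value of the birth-death chain on `{0, …, n}`. -/
def chainStatic (ρ : ℕ → ℝ) (n : ℕ) : ℝ :=
  sSup ((fun a : ℝ => D.chainValue ρ (fun _ => a) n) '' Icc 0 D.Lam)

theorem bddAbove_chainStatic {ρ : ℕ → ℝ} {n : ℕ} (hρ : ∀ i, 1 ≤ i → i ≤ n → 0 < ρ i) :
    BddAbove ((fun a : ℝ => D.chainValue ρ (fun _ => a) n) '' Icc 0 D.Lam) := by
  refine ⟨D.Lam * D.fareMax, ?_⟩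
  rintro _ ⟨a, ha, rfl⟩
  exact D.chainValue_le hρ fun _ _ => ha

theorem rates_nonempty : (Icc 0 D.Lam).Nonempty := ⟨0, le_rfl, D.Lam_pos.le⟩

theorem chainStatic_mono {ρ ρ' : ℕ → ℝ} {n : ℕ} (hρ : ∀ i, 1 ≤ i → i ≤ n → 0 < ρ' i)
    (hle : ∀ i, 1 ≤ i → i ≤ n → ρ' i ≤ ρ i) : D.chainStatic ρ' n ≤ D.chainStatic ρ n := by
  refine csSup_le (D.rates_nonempty.image _) ?_
  rintro _ ⟨a, ha, rfl⟩
  exact (D.chainValue_const_mono hρ hle ha).trans (le_csSup (D.bddAbove_chainStatic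
    fun i h1 h2 => (hρ i h1 h2).trans_le (hle i h1 h2)) ⟨a, ha, rfl⟩)

theorem chainStatic_congr {ρ ρ' : ℕ → ℝ} {n : ℕ} (hρ : ∀ i, 1 ≤ i → i ≤ n → ρ i = ρ' i) :
    D.chainStatic ρ n = D.chainStatic ρ' n := by
  unfold chainStatic
  congr 1
  exact image_congr fun a _ => D.chainValue_congr hρ fun _ _ => rfl

/-- The best static value over the chains on `{0, …, j}`, `j ≤ n`. -/
def chainBest (ρ : ℕ → ℝ) : ℕ → ℝ
  | 0 => 0
  | n + 1 => max (chainBest ρ n) (D.chainStatic ρ (n + 1))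

theorem chainBest_nonneg (ρ : ℕ → ℝ) (n : ℕ) : 0 ≤ D.chainBest ρ n := by
  induction n with
  | zero => exact le_rfl
  | succ n ih => exact ih.trans (le_max_left _ _)

theorem chainBest_mono {ρ ρ' : ℕ → ℝ} {n : ℕ} (hρ : ∀ i, 1 ≤ i → i ≤ n → 0 < ρ' i)
    (hle : ∀ i, 1 ≤ i → i ≤ n → ρ' i ≤ ρ i) : D.chainBest ρ' n ≤ D.chainBest ρ n := by
  induction n with
  | zero => exact le_rfl
  | succ n ih =>
    exact max_le_max (ih (fun i h1 h2 => hρ i h1 (by omega)) fun i h1 h2 => hle i h1 (by omega))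
      (D.chainStatic_mono hρ hle)

theorem chainBest_congr {ρ ρ' : ℕ → ℝ} {n : ℕ} (hρ : ∀ i, 1 ≤ i → i ≤ n → ρ i = ρ' i) :
    D.chainBest ρ n = D.chainBest ρ' n := by
  induction n with
  | zero => rfl
  | succ n ih =>
    rw [chainBest, chainBest, ih fun i h1 h2 => hρ i h1 (by omega), D.chainStatic_congr hρ]

/-! ### Bellman inequalities by shooting. -/

/-- If `V` exceeds the values of all pricings, then the Bellman inequalities with gain `V` have a
solution; `δ n` is the decrease of the relative value when the `n`-th rider joins. -/
theorem exists_bellman {ρ : ℕ → ℝ} {n : ℕ} {V : ℝ} (h0 : ρ 0 = 0)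
    (hρ : ∀ i, 1 ≤ i → i ≤ n → 0 < ρ i)
    (hV : ∀ x : ℕ → ℝ, (∀ i, x i ∈ Icc 0 D.Lam) → ∀ j ≤ n, D.chainValue ρ x j < V) :
    ∃ δ : ℕ → ℝ, (∀ i, 0 ≤ δ i ∧ δ i ≤ D.fareMax) ∧
      (∀ i ≤ n, ρ i * δ i ≤ V + D.cr * i) ∧
      ∀ i ≤ n, ∀ a ∈ Icc 0 D.Lam, D.revenue a - a * δ (i + 1) + ρ i * δ i ≤ V + D.cr * i := by
  have hM := D.fareMax_pos
  have hV0 : 0 < V := by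
    have := hV (fun _ => 0) (fun _ => ⟨le_rfl, D.Lam_pos.le⟩) 0 (Nat.zero_le _)
    simpa [chainValue, chainReward] using this
  -- For `u ≤ 0` the value is a dummy that makes the recursion total; `hinv` shows that it is not
  -- used up to level `n`.
  have hY : ∀ u : ℝ, ∃ y, 0 ≤ y ∧ y ≤ D.fareMax ∧
      (0 < u → (∀ a ∈ Icc 0 D.Lam, D.revenue a - a * y ≤ u) ∧
      ((∃ a ∈ Icc 0 D.Lam, 0 < a ∧ D.revenue a - a * y = u) ∨
        (y = 0 ∧ ∀ a ∈ Icc 0 D.Lam, D.revenue a ≤ u))) := fun u => by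
    by_cases hu : 0 < u
    · obtain ⟨y, h1, h2, h3⟩ := D.exists_shadow_price hu
      exact ⟨y, h1, h2, fun _ => h3⟩
    · exact ⟨0, le_rfl, hM.le, fun h => absurd h hu⟩
  choose Y hY0 hYM hYu using hY
  -- The start `δ 0 = 0` does not matter in the inequalities, since `ρ 0 = 0`.
  let δ : ℕ → ℝ := fun i => Nat.rec 0 (fun i d => Y (V + D.cr * i - ρ i * d)) i
  have hδ : ∀ i, δ (i + 1) = Y (V + D.cr * i - ρ i * δ i) := fun _ => rfl
  -- Either every price so far is attained by a positive rate, with equality in Bellman, or `δ` has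
  -- dropped to zero because no revenue exceeds `V` plus the cost, and then it stays zero.
  have hinv : ∀ i ≤ n, 0 < V + D.cr * i - ρ i * δ i ∧
      ((δ i = 0 ∧ ∀ a ∈ Icc 0 D.Lam, D.revenue a ≤ V + D.cr * i) ∨
      ∃ x : ℕ → ℝ, (∀ j, x j ∈ Icc 0 D.Lam) ∧ ∀ j < i, 0 < x j ∧
        D.revenue (x j) - x j * δ (j + 1) = V + D.cr * j - ρ j * δ j) := by
    intro i
    induction i with
    | zero =>
      intro _
      refine ⟨by simpa [h0] using hV0, Or.inr ⟨fun _ => 0, fun _ => ⟨le_rfl, D.Lam_pos.le⟩, ?_⟩⟩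
      intro j hj
      omega
    | succ i ih =>
      intro hi
      obtain ⟨hu, h⟩ := ih (by omega)
      have hc : D.cr * i ≤ D.cr * (i + 1 : ℕ) :=
        mul_le_mul_of_nonneg_left (by exact_mod_cast Nat.le_succ i) D.cr_pos.le
      have hcn : 0 ≤ D.cr * (i + 1 : ℕ) := mul_nonneg D.cr_pos.le (Nat.cast_nonneg _)
      have hstep : (δ (i + 1) = 0 ∧ ∀ a ∈ Icc 0 D.Lam, D.revenue a ≤ V + D.cr * (i + 1 : ℕ)) ∨
          ∃ x : ℕ → ℝ, (∀ j, x j ∈ Icc 0 D.Lam) ∧ ∀ j < i + 1, 0 < x j ∧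
          D.revenue (x j) - x j * δ (j + 1) = V + D.cr * j - ρ j * δ j := by
        have hpos : 0 ≤ ρ i * δ i := by
          rcases Nat.eq_zero_or_pos i with rfl | h1
          · rw [h0, zero_mul]
          · refine mul_nonneg (hρ i h1 (by omega)).le ?_
            obtain ⟨k, rfl⟩ : ∃ k, i = k + 1 := ⟨i - 1, by omega⟩
            rw [hδ]
            exact hY0 _
        obtain ⟨h1, h2⟩ := hYu _ hu
        rw [← hδ] at h1 h2
        rcases h2 with ⟨a, ha, ha0, hae⟩ | ⟨hy, h2⟩
        · rcases h with ⟨hd, hg⟩ | ⟨x, hx, hxe⟩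
          · left
            have h3 : δ (i + 1) = 0 := by
              rw [hd, mul_zero, sub_zero] at hae
              have h4 := hg a ha
              have h5 := hY0 (V + D.cr * i - ρ i * δ i)
              rw [← hδ] at h5
              have h6 : a * δ (i + 1) ≤ a * 0 := by linarith
              exact le_antisymm (le_of_mul_le_mul_left h6 ha0) h5
            exact ⟨h3, fun b hb => (hg b hb).trans (by linarith)⟩
          · right
            refine ⟨Function.update x i a, fun j => ?_, fun j hj => ?_⟩
            · by_cases hji : j = i
              · subst hji; simpa using ha
              · simpa [hji] using hx j
            · by_cases hji : j = i
              · subst hji; simpa using ⟨ha0, hae⟩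
              · rw [Function.update_of_ne hji]
                exact hxe j (by omega)
        · left
          exact ⟨hy, fun b hb => (h2 b hb).trans (by linarith)⟩
      refine ⟨?_, hstep⟩
      rcases hstep with ⟨hd, -⟩ | ⟨x, hx, hxe⟩
      · rw [hd, mul_zero]; linarith
      -- The rates that attain the prices form a chain on `{0, …, i + 1}`. Its Bellman equalities
      -- telescope (`htel`), and a nonpositive right-hand side at the end would give it a value of
      -- at least `V`.
      · by_contra! hneg
        refine absurd (hV x hx (i + 1) hi) (not_lt.2 ?_)
        have hρ' : ∀ k, 1 ≤ k → k ≤ i + 1 → 0 < ρ k := fun k h1 h2 => hρ k h1 (by omega)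
        have hx' : ∀ j < i + 1, 0 ≤ x j := fun j hj => (hx j).1
        rw [chainValue, le_div_iff₀ (sum_chainWeight_pos hρ' hx')]
        have htel : ∀ k ≤ i + 1, ∑ j ∈ Finset.range k,
            chainWeight ρ x j * (D.revenue (x j) - D.cr * j) =
            V * ∑ j ∈ Finset.range k, chainWeight ρ x j + chainWeight ρ x k * (ρ k * δ k) := by
          intro k
          induction k with
          | zero => intro _; simp [h0]
          | succ k ihk =>
            intro hk
            rw [Finset.sum_range_succ, Finset.sum_range_succ, ihk (by omega),
              ← mul_assoc (chainWeight ρ x (k + 1)), chainWeight_succ (hρ' (k + 1) (by omega) hk)]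
            have h7 : D.revenue (x k) - D.cr * k = V + x k * δ (k + 1) - ρ k * δ k := by
              linarith [(hxe k (by omega)).2]
            rw [h7]
            ring
        rw [Finset.sum_range_succ, Finset.sum_range_succ (n := i + 1)]
        have e1 : ∀ j ∈ Finset.range (i + 1), chainWeight ρ x j * D.chainReward x (i + 1) j =
            chainWeight ρ x j * (D.revenue (x j) - D.cr * j) := fun j hj => by
          rw [chainReward, if_pos (Finset.mem_range.1 hj)]
        rw [Finset.sum_congr rfl e1, htel _ le_rfl, chainReward, if_neg (lt_irrefl _)]
        have hw := chainWeight_nonneg hρ' hx' (le_refl (i + 1))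
        have h8 := mul_le_mul_of_nonneg_left hneg hw
        linarith
  refine ⟨δ, fun i => ?_, fun i hi => by linarith [(hinv i hi).1], fun i hi a ha => ?_⟩
  · cases i with
    | zero => exact ⟨le_rfl, hM.le⟩
    | succ i => rw [hδ]; exact ⟨hY0 _, hYM _⟩
  · have := (hYu _ (hinv i hi).1).1 a ha
    rw [← hδ] at this
    linarith

end Model

namespace Model

variable (D : Model)

/-! ### Values of paths -/

/-- A path whose `i`-th state, for `i ≤ n`, has `k + i` riders in the system. -/
structure IsLevelPath (P : List State) (k n : ℕ) : Prop where
  length_eq : P.length = n + 1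
  level_nth : ∀ i ≤ n, (nth P i).1 + (nth P i).2 = k + i

theorem nth_append_left {P : List State} {s : State} {i : ℕ} (h : i < P.length) :
    nth (P ++ [s]) i = nth P i := by
  simp [nth, List.getD_eq_getElem?_getD, List.getElem?_append_left h]

theorem nth_append_last {P : List State} {s : State} {i : ℕ} (h : i = P.length) :
    nth (P ++ [s]) i = s := by
  subst h
  simp [nth, List.getD_eq_getElem?_getD]

theorem IsLevelPath.append {P : List State} {k n : ℕ} (h : IsLevelPath P k n) {s : State}
    (hs : s.1 + s.2 = k + n + 1) : IsLevelPath (P ++ [s]) k (n + 1) where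
  length_eq := by simp [h.length_eq]
  level_nth i hi := by
    rcases (show i ≤ n + 1 from hi).eq_or_lt with rfl | h2
    · rw [nth_append_last h.length_eq.symm]; omega
    · rw [nth_append_left (by rw [h.length_eq]; exact h2)]
      exact h.level_nth i (by omega)

theorem isLevelPath_boxPath (a b : ℕ) : IsLevelPath (D.boxPath a b) 0 (a + b) where
  length_eq := D.boxPath_length a b
  level_nth i hi := by rw [D.nth_boxPath hi, clip_level, zero_add]

/-- Levels strictly increase, so the last state does not recur in `dropLast`. -/
theorem IsLevelPath.pathRate_nth {P : List State} {k n i : ℕ} (h : IsLevelPath P k n) (hi : i ≤ n)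
    (x : State → ℝ) : pathRate P x (nth P i) = if i < n then x (nth P i) else 0 := by
  have hmem : nth P i ∈ P.dropLast ↔ i < n := by
    rw [List.mem_iff_getElem]
    have hnth : ∀ j (hj : j < P.length), nth P j = P[j] := fun j hj => by
      simp [nth, List.getD_eq_getElem?_getD, List.getElem?_eq_getElem hj]
    constructor
    · rintro ⟨j, hj, he⟩
      rw [List.length_dropLast, h.length_eq] at hj
      rw [List.getElem_dropLast, ← hnth] at he
      have h1 := h.level_nth i hi
      rw [← he, h.level_nth j (by omega)] at h1
      omega
    · intro hin
      refine ⟨i, by rw [List.length_dropLast, h.length_eq]; omega, ?_⟩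
      rw [List.getElem_dropLast, ← hnth]
  unfold pathRate
  by_cases hin : i < n
  · rw [if_pos (hmem.2 hin), if_pos hin]
  · rw [if_neg (mt hmem.1 hin), if_neg hin]

/-- The point where equal penalty coefficients enter: busy drivers and waiting riders cost the same.
-/
theorem reward_eq (hc : D.cd = D.cr) (x : ℝ) {s : State} {n : ℕ} (hs : s.1 + s.2 = n) :
    D.reward x s = D.revenue x - D.cr * n := by
  rw [← hs, reward, hc, revenue]
  push_cast
  ring

theorem IsLevelPath.pathWeight_eq {P : List State} {k n i : ℕ} (h : IsLevelPath P k n) (hi : i ≤ n)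
    (x : State → ℝ) : D.pathWeight P x i =
      chainWeight (fun j => D.serviceRate (nth P j)) (fun j => x (nth P j)) i := by
  refine Finset.prod_congr rfl fun j hj => ?_
  have := Finset.mem_range.1 hj
  rw [h.pathRate_nth (by omega), if_pos (by omega)]

/-- Numbering a path that starts at level `k` from zero saves `cr * k` in every state. The case `k >
0` is needed for the table's paths starting at `(0, m)` with `m > 0`. -/
theorem IsLevelPath.pathValue_eq (hc : D.cd = D.cr) {P : List State} {k n : ℕ}
    (h : IsLevelPath P k n) (hρ : ∀ i, 1 ≤ i → i ≤ n → 0 < D.serviceRate (nth P i)) {x : State → ℝ}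
    (hx : ∀ s, 0 ≤ x s) : D.pathValue P x =
      D.chainValue (fun j => D.serviceRate (nth P j)) (fun j => x (nth P j)) n - D.cr * k := by
  have hW := sum_chainWeight_pos (ρ := fun j => D.serviceRate (nth P j))
    (x := fun j => x (nth P j)) hρ fun i _ => hx (nth P i)
  have hw : ∀ i ∈ Finset.range (n + 1), D.pathWeight P x i =
      chainWeight (fun j => D.serviceRate (nth P j)) (fun j => x (nth P j)) i := fun i hi =>
    h.pathWeight_eq D (by have := Finset.mem_range.1 hi; omega) x
  unfold pathValue chainValue
  rw [h.length_eq, Finset.sum_congr rfl hw, eq_sub_iff_add_eq, eq_div_iff hW.ne', add_mul,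
    Finset.sum_mul, Finset.mul_sum, ← Finset.sum_add_distrib]
  refine Finset.sum_congr rfl fun i hi => ?_
  have hi' : i ≤ n := by have := Finset.mem_range.1 hi; omega
  rw [hw i hi, D.reward_eq hc _ (h.level_nth i hi'), h.pathRate_nth hi', chainReward]
  have : ∀ r : ℝ, chainWeight (fun j => D.serviceRate (nth P j)) (fun j => x (nth P j)) i /
      (∑ k ∈ Finset.range (n + 1), chainWeight (fun j => D.serviceRate (nth P j))
        (fun j => x (nth P j)) k) * r * (∑ k ∈ Finset.range (n + 1), chainWeight
        (fun j => D.serviceRate (nth P j)) (fun j => x (nth P j)) k) =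
      chainWeight (fun j => D.serviceRate (nth P j)) (fun j => x (nth P j)) i * r := fun r => by
    field_simp
  rw [this]
  push_cast
  split_ifs
  · ring
  · rw [revenue_zero]; ring

theorem IsLevelPath.staticValue_eq (hc : D.cd = D.cr) {P : List State} {n : ℕ}
    (h : IsLevelPath P 0 n) (hρ : ∀ i, 1 ≤ i → i ≤ n → 0 < D.serviceRate (nth P i)) :
    D.staticValue P = D.chainStatic (fun j => D.serviceRate (nth P j)) n := by
  unfold staticValue chainStatic
  congr 1
  refine image_congr fun a ha => ?_
  rw [h.pathValue_eq D hc hρ fun _ => ha.1]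
  simp

/-! ### The table -/

/-- The table entry `c` holds the zigzag path clipped to the box `[0, l] × [0, m]`. -/
structure IsBoxCell (l m : ℕ) (c : Cell) : Prop where
  path_eq : c.path = D.boxPath l m
  value_eq : c.value = D.chainBest (fun i => D.serviceRate (D.clip l m i)) (l + m)

/-- Service rates along the clipped zigzag path, continued by the state `s`. -/
def extendedRate (l m : ℕ) (s : State) (i : ℕ) : ℝ :=
  if i ≤ l + m then D.serviceRate (D.clip l m i) else D.serviceRate s

theorem serviceRate_clip_pos {l m i : ℕ} (hl : 1 ≤ l) (hL : l ≤ D.L) (h1 : 1 ≤ i) (h2 : i ≤ l + m) :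
    0 < D.serviceRate (D.clip l m i) :=
  D.serviceRate_pos _ (D.one_le_clip_fst hl h1) ((D.clip_fst_le h2).trans hL)

theorem extendedRate_pos {l m i : ℕ} {s : State} (hl : 1 ≤ l ∨ m = 0) (hL : l ≤ D.L) (hs : 1 ≤ s.1)
    (hsL : s.1 ≤ D.L) (h1 : 1 ≤ i) : 0 < D.extendedRate l m s i := by
  unfold extendedRate
  split_ifs with h
  · exact D.serviceRate_clip_pos (by omega) hL h1 h
  · exact D.serviceRate_pos _ hs hsL

-- Reduces a candidate of the update to a function of service rates alone. The condition `1 ≤ l ∨ m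
-- = 0` excludes row 0 with a queue, where service rates vanish.
variable {D} in
theorem IsBoxCell.max_eq (hc : D.cd = D.cr) {l m : ℕ} {c : Cell} (h : D.IsBoxCell l m c) {s : State}
    (hl : 1 ≤ l ∨ m = 0) (hL : l ≤ D.L) (hs : 1 ≤ s.1) (hsL : s.1 ≤ D.L)
    (hlev : s.1 + s.2 = l + m + 1) :
    max c.value (D.staticValue (c.path ++ [s])) =
      D.chainBest (D.extendedRate l m s) (l + m + 1) := by
  have hP : IsLevelPath (c.path ++ [s]) 0 (l + m + 1) := by
    rw [h.path_eq]
    exact (D.isLevelPath_boxPath l m).append (by omega)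
  have hr : ∀ i ≤ l + m + 1,
      D.serviceRate (nth (c.path ++ [s]) i) = D.extendedRate l m s i := fun i hi => by
    have hlen : c.path.length = l + m + 1 := by rw [h.path_eq, boxPath_length]
    unfold extendedRate
    split_ifs with h1
    · rw [nth_append_left (by omega), h.path_eq, D.nth_boxPath h1]
    · rw [nth_append_last (by omega)]
  rw [chainBest, h.value_eq, hP.staticValue_eq D hc fun i h1 h2 => by
    rw [hr i h2]; exact D.extendedRate_pos hl hL hs hsL h1]
  congr 1
  · exact D.chainBest_congr fun i h1 h2 => by rw [extendedRate, if_pos h2]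
  · exact D.chainStatic_congr fun i h1 h2 => hr i h2

theorem boxPath_append {a b a' b' : ℕ} (hab : a + b = a' + b' + 1)
    (h : ∀ i ≤ a' + b', D.clip a b i = D.clip a' b' i) :
    D.boxPath a b = D.boxPath a' b' ++ [(a, b)] := by
  unfold boxPath
  rw [hab, List.range_succ, List.map_append, List.map_singleton, D.clip_last hab.symm]
  congr 1
  exact List.map_congr_left fun i hi => h i (by have := List.mem_range.1 hi; omega)

theorem chainBest_extendedRate {a b a' b' : ℕ} (hab : a + b = a' + b' + 1)
    (h : ∀ i ≤ a' + b', D.clip a b i = D.clip a' b' i) :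
    D.chainBest (D.extendedRate a' b' (a, b)) (a' + b' + 1) =
      D.chainBest (fun i => D.serviceRate (D.clip a b i)) (a + b) := by
  rw [hab]
  refine D.chainBest_congr fun i h1 h2 => ?_
  unfold extendedRate
  split_ifs with h3
  · rw [h i h3]
  · rw [D.clip_last (by omega)]

theorem isBoxCell_firstColumn (hc : D.cd = D.cr) {l : ℕ} (hl : l ≤ D.L) :
    D.IsBoxCell l 0 (D.firstColumn l) := by
  induction l with
  | zero => exact ⟨by simp [firstColumn, boxPath, clip_zero], rfl⟩
  | succ l ih =>
    have h := ih (by omega)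
    have hclip : ∀ i ≤ l + 0, D.clip (l + 1) 0 i = D.clip l 0 i := fun i hi => by
      rw [clip_first_column (by omega), clip_first_column (by omega)]
    constructor
    · rw [D.boxPath_append (by omega) hclip, firstColumn, h.path_eq]
    · rw [firstColumn, h.max_eq hc (Or.inr rfl) (by omega) (by simp) hl (by simp),
        D.chainBest_extendedRate (by omega) hclip]

/-- A weak inequality suffices because the tie-break favours the same side. -/
theorem update_eq_left {above left : Cell} {l m : ℕ} (h : ¬ D.Type1 (l, m))
    (hle : max above.value (D.staticValue (above.path ++ [(l + 1, m)])) ≤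
      max left.value (D.staticValue (left.path ++ [(l + 1, m)]))) :
    D.update above left l m = ⟨left.path ++ [(l + 1, m)],
      max left.value (D.staticValue (left.path ++ [(l + 1, m)]))⟩ := by
  unfold update
  simp only
  rw [if_neg h, if_neg hle.not_gt, ite_self]

theorem update_eq_above {above left : Cell} {l m : ℕ} (h : D.Type1 (l, m))
    (hle : max left.value (D.staticValue (left.path ++ [(l + 1, m)])) ≤
      max above.value (D.staticValue (above.path ++ [(l + 1, m)]))) :
    D.update above left l m = ⟨above.path ++ [(l + 1, m)],
      max above.value (D.staticValue (above.path ++ [(l + 1, m)]))⟩ := by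
  unfold update
  simp only
  rw [if_pos h, if_neg hle.not_gt]
  split_ifs with h2
  · rfl
  · rw [le_antisymm hle (not_lt.1 h2)]

theorem IsBoxCell.update_left (hc : D.cd = D.cr) (hD : D.DiminishingReturns) {above left : Cell}
    {l m : ℕ} (hl : l + 1 ≤ D.L) (hleft : D.IsBoxCell (l + 1) m left) (h : D.Type2 (l, m + 1))
    (hle : max above.value (D.staticValue (above.path ++ [(l + 1, m + 1)])) ≤
      D.chainBest (D.extendedRate (l + 1) m (l + 1, m + 1)) (l + 1 + m + 1)) :
    D.IsBoxCell (l + 1) (m + 1) (D.update above left l (m + 1)) := by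
  have hmax := hleft.max_eq hc (s := (l + 1, m + 1)) (Or.inl (by omega)) hl (by simp) hl
    (by simp only; omega)
  have hclip : ∀ i ≤ l + 1 + m, D.clip (l + 1) (m + 1) i = D.clip (l + 1) m i :=
    fun i hi => clip_of_type2 hD h hi
  rw [D.update_eq_left (fun h1 => (D.type1_iff_not_type2 (by omega)).1 h1 h)
    (hle.trans_eq hmax.symm)]
  constructor
  · rw [D.boxPath_append (by omega) hclip, hleft.path_eq]
  · rw [← D.chainBest_extendedRate (by omega) hclip]
    exact hmax

/-- The type of `(l, m + 1)` tells from which side the clipped path enters the corner. The other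
candidate stays in the same box, so it is no faster on any level, and `chainBest_mono` applies. -/
theorem IsBoxCell.update (hc : D.cd = D.cr) (hD : D.DiminishingReturns) {above left : Cell}
    {l m : ℕ} (h0 : 1 ≤ l) (hl : l + 1 ≤ D.L) (habove : D.IsBoxCell l (m + 1) above)
    (hleft : D.IsBoxCell (l + 1) m left) :
    D.IsBoxCell (l + 1) (m + 1) (D.update above left l (m + 1)) := by
  have hmaxL := hleft.max_eq hc (s := (l + 1, m + 1)) (Or.inl (by omega)) hl (by simp) hl
    (by simp only; omega)
  have hmaxA := habove.max_eq hc (s := (l + 1, m + 1)) (Or.inl h0) (by omega) (by simp) hl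
    (by simp only; omega)
  have hn : l + 1 + m = l + (m + 1) := by omega
  by_cases h : D.Type2 (l, m + 1)
  · refine IsBoxCell.update_left D hc hD hl hleft h ?_
    rw [hmaxA, hn]
    refine D.chainBest_mono (fun i h1 _ => D.extendedRate_pos (Or.inl h0) (by omega) (by simp) hl h1)
      fun i h1 h2 => ?_
    unfold extendedRate
    rw [hn]
    split_ifs with h3
    · rw [← clip_of_type2 hD h (by omega)]
      have h4 := hD.serviceRate_le_clip (a := l + 1) (b := m + 1) hl
        ((D.clip_fst_le h3).trans (Nat.le_succ _)) (D.clip_snd_le l (m + 1) i)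
      rwa [clip_level] at h4
    · exact le_rfl
  · have h' := (D.type1_iff_not_type2 (show l ≤ D.L by omega)).2 h
    have hclip : ∀ i ≤ l + (m + 1), D.clip (l + 1) (m + 1) i = D.clip l (m + 1) i :=
      fun i hi => clip_of_type1 hD (by omega) h' hi
    rw [D.update_eq_above h' ?_]
    · constructor
      · rw [D.boxPath_append (by omega) hclip, habove.path_eq]
      · rw [← D.chainBest_extendedRate (by omega) hclip]
        exact hmaxA
    · rw [hmaxA, hmaxL, hn]
      refine D.chainBest_mono (fun i h1 _ => D.extendedRate_pos (Or.inl (by omega)) hl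
        (by simp) hl h1) fun i h1 h2 => ?_
      unfold extendedRate
      rw [hn]
      split_ifs with h3
      · rw [← hclip i h3]
        have h4 := hD.serviceRate_le_clip (a := l + 1) (b := m + 1) hl
          (D.clip_fst_le (show i ≤ l + 1 + m by omega))
          ((D.clip_snd_le (l + 1) m i).trans (Nat.le_succ _))
        rwa [clip_level] at h4
      · exact le_rfl

/-- The candidate from above is the stub `(0, m + 1), (1, m + 1)`, not a path from `(0, 0)`. It
consists of the last two levels only and is handled by `chainValue_last_two_le`. -/
theorem IsBoxCell.update_row_one (hc : D.cd = D.cr) (hD : D.DiminishingReturns) {left : Cell}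
    {m : ℕ} (hleft : D.IsBoxCell 1 m left) :
    D.IsBoxCell 1 (m + 1) (D.update ⟨[(0, m + 1)], 0⟩ left 0 (m + 1)) := by
  have hL := D.one_le_L
  refine IsBoxCell.update_left D hc hD hL hleft ?_ ?_
  · rw [hD.type2_iff]
    exact D.one_le_busy (by omega)
  · refine max_le (D.chainBest_nonneg _ _) (csSup_le (D.rates_nonempty.image _) ?_)
    rintro _ ⟨a, ha, rfl⟩
    refine le_trans ?_ (le_max_right _ _)
    have hpos := D.serviceRate_pos (m + 1) one_pos hL
    have hP : IsLevelPath [(0, m + 1), (1, m + 1)] (m + 1) 1 := by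
      refine ⟨rfl, fun i hi => ?_⟩
      interval_cases i <;> simp [nth]; omega
    have hn1 : nth [(0, m + 1), (1, m + 1)] 1 = (1, m + 1) := rfl
    have hone : ∀ i, 1 ≤ i → i ≤ 1 → D.serviceRate (nth [(0, m + 1), (1, m + 1)] i) =
        D.serviceRate (1, m + 1) := fun i h1 h2 => by rw [le_antisymm h2 h1, hn1]
    have hext : ∀ i, 1 ≤ i → i ≤ 1 + m + 1 → 0 < D.extendedRate 1 m (1, m + 1) i :=
      fun i h1 _ => D.extendedRate_pos (Or.inl le_rfl) hL le_rfl hL h1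
    have h1 : D.pathValue [(0, m + 1), (1, m + 1)] (fun _ => a) = _ :=
      hP.pathValue_eq D hc (fun i h1 h2 => by rw [hone i h1 h2]; exact hpos) (fun _ => ha.1)
    have h2 := D.chainValue_last_two_le (ρ := D.extendedRate 1 m (1, m + 1)) (n := 1 + m) hpos hext
      (by rw [extendedRate, if_neg (by omega)]) ha
    have h3 : D.chainValue (fun j => D.serviceRate (nth [(0, m + 1), (1, m + 1)] j))
        (fun _ => a) 1 = D.chainValue (fun _ => D.serviceRate (1, m + 1)) (fun _ => a) 1 :=
      D.chainValue_congr hone fun _ _ => rfl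
    have h4 : D.pathValue [(0, m + 1), (1, m + 1)] (fun _ => a) ≤
        D.chainValue (D.extendedRate 1 m (1, m + 1)) (fun _ => a) (1 + m + 1) := by
      rw [h1, h3, add_comm m 1]
      rw [add_comm m 1] at h2
      exact h2
    exact h4.trans (le_csSup (D.bddAbove_chainStatic hext) ⟨a, ha, rfl⟩)

theorem isBoxCell_table (hc : D.cd = D.cr) (hD : D.DiminishingReturns) {m l : ℕ}
    (hl : 1 ≤ l) (hL : l ≤ D.L) : D.IsBoxCell l m (D.table m l) := by
  induction m generalizing l with
  | zero => exact D.isBoxCell_firstColumn hc hL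
  | succ m ih =>
    induction l, hl using Nat.le_induction with
    | base => exact IsBoxCell.update_row_one D hc hD (ih le_rfl hL)
    | succ l h0 ihl => exact IsBoxCell.update D hc hD h0 hL (ihl (by omega)) (ih (by omega) hL)

theorem outputPath_eq (hc : D.cd = D.cr) (hD : D.DiminishingReturns) (M : ℕ) :
    D.outputPath M = D.boxPath D.L M :=
  (D.isBoxCell_table hc hD D.one_le_L le_rfl).path_eq

end Model

namespace Model

variable (D : Model)

/-! ### Stationary regimes on a path -/

/-- Under `q`, the states `p 0, …, p n` form a closed class on which the chain is a birth-death
chain; all other states up to level `n` reject, and no state with all drivers idle and a nonempty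
queue is held. -/
structure IsPathRegime (q : Policy) (p : ℕ → State) (n : ℕ) : Prop where
  level_eq : ∀ i ≤ n, (p i).1 + (p i).2 = i
  fst_le : ∀ i ≤ n, (p i).1 ≤ D.L
  hold : ∀ i ≤ n, q.dispatch (p i) = false
  rate_pos : ∀ i < n, 0 < q.rate (p i)
  rate_last : q.rate (p n) = 0
  rate_off : ∀ s : State, s.1 + s.2 ≤ n → s ≠ p (s.1 + s.2) → q.rate s = 0
  up : ∀ i < n, settle q.dispatch (p i).1 ((p i).2 + 1) = p (i + 1)
  down : ∀ i < n, settle q.dispatch ((p (i + 1)).1 - 1) (p (i + 1)).2 = p i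
  row_zero : ∀ m, q.dispatch (0, m + 1) = true

/-- Unnormalised stationary weights along a path. -/
def pathChainWeight (q : Policy) (p : ℕ → State) : ℕ → ℝ :=
  chainWeight (fun i => D.serviceRate (p i)) fun i => q.rate (p i)

/-- The stationary distribution on the path `p 0, …, p n`. -/
def pathLaw (q : Policy) (p : ℕ → State) (n : ℕ) (s : State) : ℝ :=
  open Classical in
  if s.1 + s.2 ≤ n ∧ s = p (s.1 + s.2) then
    D.pathChainWeight q p (s.1 + s.2) / ∑ i ∈ Finset.range (n + 1), D.pathChainWeight q p i
  else 0

variable {D} {q : Policy} {p : ℕ → State} {n : ℕ}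

theorem IsPathRegime.service_pos (h : D.IsPathRegime q p n) {s : State} (hs : s.1 ≤ D.L)
    (hq : q.dispatch s = false) (h1 : 1 ≤ s.1 + s.2) : 0 < D.serviceRate s := by
  obtain ⟨l, m⟩ := s
  refine D.serviceRate_pos m (Nat.pos_of_ne_zero ?_) hs
  rintro rfl
  obtain ⟨k, rfl⟩ : ∃ k, m = k + 1 := ⟨m - 1, by simp only at h1; omega⟩
  rw [h.row_zero] at hq
  contradiction

theorem IsPathRegime.service_path_pos (h : D.IsPathRegime q p n) {i : ℕ} (h1 : 1 ≤ i) (hi : i ≤ n) :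
    0 < D.serviceRate (p i) :=
  h.service_pos (h.fst_le i hi) (h.hold i hi) (by rw [h.level_eq i hi]; exact h1)

theorem IsPathRegime.weight_pos (h : D.IsPathRegime q p n) {i : ℕ} (hi : i ≤ n) :
    0 < D.pathChainWeight q p i :=
  chainWeight_pos (fun _ h1 h2 => h.service_path_pos h1 h2) h.rate_pos hi

theorem IsPathRegime.total_pos (h : D.IsPathRegime q p n) :
    0 < ∑ i ∈ Finset.range (n + 1), D.pathChainWeight q p i :=
  sum_chainWeight_pos (fun _ h1 h2 => h.service_path_pos h1 h2) fun i hi => (h.rate_pos i hi).le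

theorem IsPathRegime.weight_succ (h : D.IsPathRegime q p n) {i : ℕ} (hi : i < n) :
    D.pathChainWeight q p (i + 1) * D.serviceRate (p (i + 1)) =
      D.pathChainWeight q p i * q.rate (p i) :=
  chainWeight_succ (ρ := fun i => D.serviceRate (p i)) (h.service_path_pos (by omega) hi)

theorem IsPathRegime.pathLaw_path (h : D.IsPathRegime q p n) {i : ℕ} (hi : i ≤ n) :
    D.pathLaw q p n (p i) =
      D.pathChainWeight q p i / ∑ i ∈ Finset.range (n + 1), D.pathChainWeight q p i := by
  rw [pathLaw, h.level_eq i hi, if_pos ⟨hi, rfl⟩]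

theorem pathLaw_off {s : State} (hs : ¬ (s.1 + s.2 ≤ n ∧ s = p (s.1 + s.2))) :
    D.pathLaw q p n s = 0 := if_neg hs

theorem IsPathRegime.sum_level (h : D.IsPathRegime q p n) (f : State → ℝ) (i : ℕ) :
    ∑ s ∈ level i, D.pathLaw q p n s * f s =
      if i ≤ n then D.pathLaw q p n (p i) * f (p i) else 0 := by
  split_ifs with hi
  · refine Finset.sum_eq_single (p i) (fun s hs hne => ?_) fun hs => ?_
    · rw [mem_level] at hs
      rw [pathLaw_off (by rw [hs]; exact fun h2 => hne h2.2), zero_mul]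
    · exact absurd (mem_level.2 (h.level_eq i hi)) hs
  · refine Finset.sum_eq_zero fun s hs => ?_
    rw [mem_level] at hs
    rw [pathLaw_off (by rw [hs]; exact fun h2 => hi h2.1), zero_mul]

theorem IsPathRegime.hasSum (h : D.IsPathRegime q p n) (f : State → ℝ) :
    HasSum (fun s => D.pathLaw q p n s * f s)
      ((∑ i ∈ Finset.range (n + 1), D.pathChainWeight q p i * f (p i)) /
        ∑ i ∈ Finset.range (n + 1), D.pathChainWeight q p i) := by
  classical
  have hinj : Set.InjOn p (Finset.range (n + 1) : Set ℕ) := fun i hi j hj hij => by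
    rw [Finset.coe_range, mem_Iio] at hi hj
    rw [← h.level_eq i (by omega), hij, h.level_eq j (by omega)]
  have h1 : HasSum (fun s => D.pathLaw q p n s * f s)
      (∑ s ∈ (Finset.range (n + 1)).image p, D.pathLaw q p n s * f s) := by
    refine hasSum_sum_of_ne_finset_zero fun s hs => ?_
    rw [pathLaw_off, zero_mul]
    rintro ⟨h2, h3⟩
    exact hs (Finset.mem_image.2 ⟨_, Finset.mem_range.2 (by omega), h3.symm⟩)
  rw [Finset.sum_image hinj] at h1
  convert h1 using 1
  rw [Finset.sum_div]
  refine Finset.sum_congr rfl fun i hi => ?_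
  rw [h.pathLaw_path (by have := Finset.mem_range.1 hi; omega)]
  ring

theorem IsPathRegime.transRate_up_path (h : D.IsPathRegime q p n) {i : ℕ} (hi : i ≤ n) {t : State}
    (ht : t.1 + t.2 = i + 1) [Decidable (i < n ∧ t = p (i + 1))] :
    D.transRate q (p i) t = if i < n ∧ t = p (i + 1) then q.rate (p i) else 0 := by
  classical
  rw [D.transRate_up (by rw [h.level_eq i hi, ht])]
  rcases hi.eq_or_lt with rfl | hlt
  · simp [h.rate_last]
  · rw [h.up i hlt]
    simp [hlt, eq_comm]

theorem IsPathRegime.transRate_down_path (h : D.IsPathRegime q p n) {i : ℕ} (hi : i < n) {t : State}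
    (ht : t.1 + t.2 = i) [Decidable (t = p i)] :
    D.transRate q (p (i + 1)) t = if t = p i then D.serviceRate (p (i + 1)) else 0 := by
  classical
  rw [D.transRate_down (by rw [h.level_eq (i + 1) hi, ht]), h.down i hi]
  simp [eq_comm]

theorem IsPathRegime.isStationary (h : D.IsPathRegime q p n) :
    D.IsStationary q (D.pathLaw q p n) := by
  classical
  have hW := h.total_pos
  refine ⟨fun s => ?_, ?_, fun s hs => pathLaw_off ?_, fun s hs => pathLaw_off ?_, fun t => ?_⟩
  · unfold pathLaw
    split_ifs with h1
    · exact div_nonneg (h.weight_pos h1.1).le hW.le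
    · exact le_rfl
  · have := h.hasSum fun _ => 1
    simpa [div_self hW.ne'] using this
  · rintro ⟨h1, h2⟩
    have := h.fst_le _ h1
    rw [← h2] at this
    omega
  · rintro ⟨h1, h2⟩
    have := h.hold _ h1
    rw [← h2, hs] at this
    contradiction
  · obtain ⟨j, hj⟩ : ∃ j, j = t.1 + t.2 := ⟨_, rfl⟩
    have hout : ∀ i < n, D.pathLaw q p n (p (i + 1)) * D.serviceRate (p (i + 1)) =
        D.pathLaw q p n (p i) * q.rate (p i) := fun i hi => by
      rw [h.pathLaw_path hi, h.pathLaw_path hi.le, div_mul_eq_mul_div, h.weight_succ hi]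
      ring
    have hdown : ∑ s ∈ level (j + 1), D.pathLaw q p n s * D.transRate q s t =
        if j ≤ n ∧ t = p j then D.pathLaw q p n t * q.rate t else 0 := by
      rw [h.sum_level]
      by_cases hjn : j + 1 ≤ n
      · rw [if_pos hjn, h.transRate_down_path hjn hj.symm]
        by_cases ht : t = p j
        · rw [if_pos ht, if_pos ⟨by omega, ht⟩, hout j hjn, ← ht]
        · rw [if_neg ht, if_neg fun h2 => ht h2.2, mul_zero]
      · rw [if_neg hjn]
        split_ifs with h2
        · obtain rfl : j = n := by omega
          rw [h2.2, h.rate_last, mul_zero]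
        · rfl
    have hlhs : D.pathLaw q p n t * (q.rate t + D.serviceRate t) =
        (if j ≤ n ∧ t = p j then D.pathLaw q p n t * q.rate t else 0) +
        if j ≤ n ∧ t = p j then D.pathLaw q p n t * D.serviceRate t else 0 := by
      split_ifs with h2
      · ring
      · rw [pathLaw_off (by rw [← hj]; exact h2)]; ring
    rw [hlhs]
    rcases Nat.eq_zero_or_pos j with h0 | h0
    · rw [D.inflow_zero q _ (by omega)]
      rw [h0] at hdown
      rw [zero_add] at hdown
      rw [hdown, h0, add_eq_left]
      have : t = (0, 0) := Prod.ext (by simp only; omega) (by simp only; omega)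
      rw [this, serviceRate_zero, mul_zero, ite_self]
    · obtain ⟨i, rfl⟩ : ∃ i, j = i + 1 := ⟨j - 1, by omega⟩
      rw [D.inflow_succ q _ hj.symm, hdown, add_comm]
      congr 1
      rw [h.sum_level]
      by_cases hi : i ≤ n
      · rw [if_pos hi, h.transRate_up_path hi hj.symm]
        by_cases h2 : i < n ∧ t = p (i + 1)
        · rw [if_pos h2, if_pos (⟨h2.1, h2.2⟩ : i + 1 ≤ n ∧ t = p (i + 1)), h2.2, hout i h2.1]
        · rw [if_neg h2, if_neg (show ¬ (i + 1 ≤ n ∧ t = p (i + 1)) from h2), mul_zero]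
      · rw [if_neg hi, if_neg (by omega)]

/-- A held state above level 0 has a busy driver, hence positive service; other states carry no mass
anyway. -/
theorem IsPathRegime.eq_zero_of_flow_eq_zero (h : D.IsPathRegime q p n) {π : State → ℝ}
    (hπ : D.IsStationary q π) {s : State} (hs : 1 ≤ s.1 + s.2) (h0 : π s * D.serviceRate s = 0) :
    π s = 0 := by
  by_cases h1 : s.1 ≤ D.L
  · cases h2 : q.dispatch s
    · exact (mul_eq_zero.1 h0).resolve_right (h.service_pos h1 h2 hs).ne'
    · exact hπ.support_hold s h2
  · exact hπ.support_states s (by omega)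

/-- Every state of level `n` rejects, so the cut equation empties the next level, and then each
later one in turn. -/
theorem IsPathRegime.eq_zero_above (h : D.IsPathRegime q p n) {π : State → ℝ}
    (hπ : D.IsStationary q π) {i : ℕ} (hi : n + 1 ≤ i) : ∀ s ∈ level i, π s = 0 := by
  have hstep : ∀ i, ∑ s ∈ level i, π s * q.rate s = 0 → ∀ s ∈ level (i + 1), π s = 0 := by
    intro i h0 s hs
    rw [hπ.cut, Finset.sum_eq_zero_iff_of_nonneg] at h0
    · exact h.eq_zero_of_flow_eq_zero hπ (by rw [mem_level.1 hs]; omega) (h0 s hs)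
    · intro s _
      by_cases h1 : s.1 ≤ D.L
      · exact mul_nonneg (hπ.nonneg s) (D.serviceRate_nonneg _ h1)
      · rw [hπ.support_states s (by omega), zero_mul]
  induction i, hi using Nat.le_induction with
  | base =>
    refine hstep n (Finset.sum_eq_zero fun s hs => ?_)
    rw [mem_level] at hs
    by_cases h1 : s = p n
    · rw [h1, h.rate_last, mul_zero]
    · rw [h.rate_off s hs.le (by rwa [hs]), mul_zero]
  | succ i _ ih => exact hstep i (Finset.sum_eq_zero fun s hs => by rw [ih s hs, zero_mul])

/-- Downward induction on the level: an off-path state could receive mass only from off-path states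
above it, which are empty, or from off-path states below, which reject; path states jump to the
path. -/
theorem IsPathRegime.eq_zero_off (h : D.IsPathRegime q p n) {π : State → ℝ}
    (hπ : D.IsStationary q π) (k : ℕ) : ∀ i, i + k = n + 1 → ∀ s ∈ level i,
      ¬ (i ≤ n ∧ s = p i) → π s = 0 := by
  classical
  induction k with
  | zero => exact fun i hi s hs _ => h.eq_zero_above hπ (by omega) s hs
  | succ k ih =>
    intro i hi t ht hne
    have hne' : t ≠ p i := fun h2 => hne ⟨by omega, h2⟩
    rcases Nat.eq_zero_or_pos i with rfl | h0
    · refine absurd ?_ hne'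
      have h1 := h.level_eq 0 (Nat.zero_le _)
      have h2 := mem_level.1 ht
      exact Prod.ext (by omega) (by omega)
    · obtain ⟨j, rfl⟩ : ∃ j, i = j + 1 := ⟨i - 1, by omega⟩
      rw [mem_level] at ht
      refine h.eq_zero_of_flow_eq_zero hπ (by omega) ?_
      have hbal := hπ.balance t
      rw [h.rate_off t (by omega) (by rwa [ht]), zero_add, D.inflow_succ q π ht] at hbal
      rw [hbal, Finset.sum_eq_zero, Finset.sum_eq_zero, add_zero]
      · intro s hs
        by_cases h1 : j + 1 + 1 ≤ n ∧ s = p (j + 1 + 1)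
        · rw [h1.2, h.transRate_down_path h1.1 ht, if_neg hne', mul_zero]
        · rw [ih (j + 1 + 1) (by omega) s hs h1, zero_mul]
      · intro s hs
        rw [mem_level] at hs
        by_cases h1 : s = p j
        · rw [h1, h.transRate_up_path (by omega) ht, if_neg fun h2 => hne' h2.2, mul_zero]
        · rw [D.transRate_up (by omega), h.rate_off s (by omega) (by rwa [hs]), ite_self, mul_zero]

/-- With all mass on the path, the cut equations fix the ratios of consecutive masses, and
normalisation does the rest. -/
theorem IsPathRegime.unique (h : D.IsPathRegime q p n) {π : State → ℝ}
    (hπ : D.IsStationary q π) : π = D.pathLaw q p n := by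
  have hoff : ∀ s : State, ¬ (s.1 + s.2 ≤ n ∧ s = p (s.1 + s.2)) → π s = 0 := fun s hs => by
    by_cases h1 : s.1 + s.2 ≤ n
    · exact h.eq_zero_off hπ (n + 1 - (s.1 + s.2)) _ (by omega) s (mem_level.2 rfl) hs
    · exact h.eq_zero_above hπ (by omega) s (mem_level.2 rfl)
  have hlev : ∀ (f : State → ℝ) (i : ℕ), i ≤ n →
      ∑ s ∈ level i, π s * f s = π (p i) * f (p i) := fun f i hi => by
    refine Finset.sum_eq_single (p i) (fun s hs hne => ?_) fun hs => ?_
    · rw [mem_level] at hs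
      rw [hoff s (by rw [hs]; exact fun h2 => hne h2.2), zero_mul]
    · exact absurd (mem_level.2 (h.level_eq i hi)) hs
  have hW := h.total_pos
  have hw : ∀ i ≤ n, π (p i) = D.pathChainWeight q p i * π (p 0) := by
    intro i
    induction i with
    | zero => intro _; rw [pathChainWeight, chainWeight_zero, one_mul]
    | succ i ih =>
      intro hi
      have h1 := hπ.cut D i
      rw [hlev _ i (by omega), hlev _ (i + 1) hi, ih (by omega)] at h1
      refine mul_right_cancel₀ (h.service_path_pos (by omega) hi).ne' ?_
      rw [← h1, mul_right_comm, ← h.weight_succ hi, mul_right_comm]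
  have hprop : ∀ s, π s =
      (π (p 0) * ∑ i ∈ Finset.range (n + 1), D.pathChainWeight q p i) * D.pathLaw q p n s :=
    fun s => by
      by_cases hs : s.1 + s.2 ≤ n ∧ s = p (s.1 + s.2)
      · obtain ⟨i, hi⟩ : ∃ i, i = s.1 + s.2 := ⟨_, rfl⟩
        rw [← hi] at hs
        rw [hs.2, h.pathLaw_path hs.1, hw i hs.1]
        field_simp
      · rw [hoff s hs, pathLaw_off hs, mul_zero]
  have h1 := h.isStationary.hasSum_one.mul_left
    (π (p 0) * ∑ i ∈ Finset.range (n + 1), D.pathChainWeight q p i)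
  rw [← funext hprop] at h1
  have h2 := hπ.hasSum_one.unique h1
  rw [mul_one] at h2
  ext s
  rw [hprop s, ← h2, one_mul]

theorem IsPathRegime.hasObjective (hc : D.cd = D.cr) (h : D.IsPathRegime q p n) :
    D.HasObjective q (D.pathLaw q p n)
      (D.chainValue (fun i => D.serviceRate (p i)) (fun i => q.rate (p i)) n) := by
  have h1 := h.hasSum fun s => D.reward (q.rate s) s
  unfold HasObjective
  convert h1 using 1
  unfold chainValue pathChainWeight
  congr 1
  refine Finset.sum_congr rfl fun i hi => ?_
  have hi' : i ≤ n := by have := Finset.mem_range.1 hi; omega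
  rw [D.reward_eq hc _ (h.level_eq i hi'), chainReward]
  split_ifs with h2
  · rfl
  · obtain rfl : i = n := by omega
    rw [h.rate_last, revenue_zero]

end Model

theorem settle_of_hold {φ : State → Bool} {l m : ℕ} (h : φ (l, m) = false) :
    settle φ l m = (l, m) := by
  cases m with
  | zero => rfl
  | succ m => rw [settle, h]; rfl

theorem settle_of_dispatch {φ : State → Bool} {l m : ℕ} (h : φ (l, m + 1) = true) :
    settle φ l (m + 1) = settle φ (l + 1) m := by
  rw [settle, h]; rfl

namespace Model

variable {D : Model}

/-! ### The dispatching rule of the clipped zigzag path -/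

theorem typeRule_eq_false (hD : D.DiminishingReturns) {l m : ℕ} :
    D.typeRule (l, m) = false ↔ D.busy (l + m) ≤ l := by
  rw [← Bool.not_eq_true, D.typeRule_eq_true, hD.type2_iff, not_lt]

theorem mem_boxPath_L {M l m : ℕ} : (l, m) ∈ D.boxPath D.L M ↔
    l + m ≤ D.L + M ∧ m ≤ M ∧ l = max (l + m - M) (D.busy (l + m)) := by
  have hb := D.busy_le_L (l + m)
  rw [mem_boxPath]
  simp only [clip, clipBusy, Prod.mk.injEq]
  omega

/-- In row `l` the path ends in the last column (at most `M`) before `busy (l + ·)` exceeds `l`;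
beyond it the states are exactly those of type 2. -/
theorem DiminishingReturns.pathDispatch_eq (hD : D.DiminishingReturns) {M l m : ℕ} (hl : l ≤ D.L)
    (hm : m ≤ M) : D.pathDispatch (D.boxPath D.L M) (l, m) = D.typeRule (l, m) := by
  classical
  rw [Bool.eq_iff_iff, D.typeRule_eq_true, hD.type2_iff]
  simp only [pathDispatch, decide_eq_true_eq, mem_boxPath_L]
  have hL := D.busy_le_L (l + m)
  constructor
  · rintro ⟨h1, ⟨k, h2, h3, h4⟩, h5⟩
    by_contra hlt
    have h6 := h5 k ⟨h2, h3, h4⟩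
    have h7 := D.busy_mono (show l + k ≤ l + m by omega)
    exact lt_irrefl m (h5 m ⟨by omega, hm, by omega⟩)
  · intro hlt
    refine ⟨by omega, ?_, ?_⟩
    · have hex : ∃ k, l < D.busy (l + k) := ⟨m, hlt⟩
      classical
      obtain ⟨k, hk, hmin⟩ : ∃ k, l < D.busy (l + k) ∧ ∀ j < k, ¬ l < D.busy (l + j) :=
        ⟨Nat.find hex, Nat.find_spec hex, fun j hj => Nat.find_min hex hj⟩
      have hkm : k ≤ m := by
        by_contra h
        exact hmin m (by omega) hlt
      have h0 : k ≠ 0 := by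
        rintro rfl
        have := D.busy_le (l + 0)
        omega
      obtain ⟨j, rfl⟩ : ∃ j, k = j + 1 := ⟨k - 1, by omega⟩
      have h1 := hmin j (by omega)
      have h2 := D.busy_succ_le (l + j)
      rw [show l + j + 1 = l + (j + 1) by omega] at h2
      exact ⟨j, by omega, by omega, by omega⟩
    · rintro k ⟨h1, h2, h3⟩
      by_contra h4
      have := D.busy_mono (show l + m ≤ l + k by omega)
      omega

theorem pathDispatch_right {M l : ℕ} (hl : l < D.L) (h : (l, M) ∈ D.boxPath D.L M) :
    D.pathDispatch (D.boxPath D.L M) (l, M + 1) = true := by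
  simp only [pathDispatch, decide_eq_true_eq]
  refine ⟨hl, ⟨M, h⟩, fun m hm => ?_⟩
  have := (mem_boxPath_L.1 hm).2.1
  omega

theorem pathDispatch_row_zero (M m : ℕ) :
    D.pathDispatch (D.boxPath D.L M) (0, m + 1) = true := by
  simp only [pathDispatch, decide_eq_true_eq]
  refine ⟨D.one_le_L, ⟨0, ?_⟩, fun k hk => ?_⟩
  · rw [mem_boxPath_L]
    simp [busy_zero]
  · rw [mem_boxPath_L] at hk
    by_contra h
    have := D.one_le_busy (show 1 ≤ 0 + k by omega)
    omega

theorem typeRule_row_zero (hD : D.DiminishingReturns) (m : ℕ) :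
    D.typeRule (0, m + 1) = true := by
  rw [D.typeRule_eq_true, hD.type2_iff]
  exact D.one_le_busy (by omega)

theorem typeRule_clip (hD : D.DiminishingReturns) (M i : ℕ) :
    D.typeRule (D.clip D.L M i) = false := by
  have h := D.clip_level D.L M i
  have hb := D.busy_le_L i
  rw [show D.clip D.L M i = ((D.clip D.L M i).1, (D.clip D.L M i).2) from rfl,
    typeRule_eq_false hD, h]
  simp only [clip, clipBusy]
  omega

/-- One dispatch at most, since the path gains at most one driver per level. On the wall `m = M` the
arrival lands in column `M + 1`, outside the range of `hφ`, which is why `hM` is assumed. -/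
theorem settle_clip_up (hD : D.DiminishingReturns) {M i : ℕ} {φ : State → Bool}
    (hφ : ∀ l ≤ D.L, ∀ m ≤ M, φ (l, m) = D.typeRule (l, m)) (hi : i < D.L + M)
    (hM : (D.clip D.L M i).2 = M → φ ((D.clip D.L M i).1, M + 1) = true) :
    settle φ (D.clip D.L M i).1 ((D.clip D.L M i).2 + 1) = D.clip D.L M (i + 1) := by
  obtain ⟨⟨l, m⟩, hs⟩ : ∃ s : State, s = D.clip D.L M i := ⟨_, rfl⟩
  have hlev := D.clip_level D.L M i
  have hlev' := D.clip_level D.L M (i + 1)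
  have hlL := D.clip_fst_le hi.le
  have hmM := D.clip_snd_le D.L M i
  have hl : (D.clip D.L M i).1 = max (i - M) (min D.L (D.busy i)) := rfl
  have hl' : (D.clip D.L M (i + 1)).1 = max (i + 1 - M) (min D.L (D.busy (i + 1))) := rfl
  have hb := D.busy_le_L (i + 1)
  have hb1 := D.busy_succ_le i
  have hb2 := D.busy_mono (show i ≤ i + 1 by omega)
  rw [← hs] at hlev hl hlL hmM hM ⊢
  simp only at hlev hl hlL hmM hM ⊢
  have hstep : φ (l, m + 1) = true → l + 1 ≤ D.L → D.busy (i + 1) ≤ l + 1 →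
      settle φ l (m + 1) = (l + 1, m) := by
    intro h1 h2 h3
    rw [settle_of_dispatch h1, settle_of_hold]
    rw [hφ _ h2 _ hmM, typeRule_eq_false hD, show l + 1 + m = i + 1 by omega]
    exact h3
  rcases hmM.eq_or_lt with hm | hm
  · rw [hstep (by rw [hm]; exact hM hm) (by omega) (by omega)]
    exact Prod.ext (by simp only; omega) (by simp only; omega)
  · by_cases h1 : D.busy (i + 1) ≤ l
    · rw [settle_of_hold]
      · exact Prod.ext (by simp only; omega) (by simp only; omega)
      · rw [hφ _ hlL _ hm, typeRule_eq_false hD, show l + (m + 1) = i + 1 by omega]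
        exact h1
    · rw [hstep _ (by omega) (by omega)]
      · exact Prod.ext (by simp only; omega) (by simp only; omega)
      · rw [hφ _ hlL _ hm, D.typeRule_eq_true, hD.type2_iff, show l + (m + 1) = i + 1 by omega]
        omega

theorem settle_clip_down (hD : D.DiminishingReturns) {M i : ℕ} {φ : State → Bool}
    (hφ : ∀ l ≤ D.L, ∀ m ≤ M, φ (l, m) = D.typeRule (l, m)) (hi : i < D.L + M) :
    settle φ ((D.clip D.L M (i + 1)).1 - 1) (D.clip D.L M (i + 1)).2 = D.clip D.L M i := by
  obtain ⟨⟨l, m⟩, hs⟩ : ∃ s : State, s = D.clip D.L M (i + 1) := ⟨_, rfl⟩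
  have hlev := D.clip_level D.L M (i + 1)
  have hlev' := D.clip_level D.L M i
  have hlL := D.clip_fst_le (show i + 1 ≤ D.L + M from hi)
  have hmM := D.clip_snd_le D.L M (i + 1)
  have hl1 := D.one_le_clip_fst (b := M) D.one_le_L (Nat.succ_pos i)
  have hl : (D.clip D.L M (i + 1)).1 = max (i + 1 - M) (min D.L (D.busy (i + 1))) := rfl
  have hl' : (D.clip D.L M i).1 = max (i - M) (min D.L (D.busy i)) := rfl
  have hb := D.busy_le_L (i + 1)
  have hb0 := D.busy_le i
  have hb1 := D.busy_succ_le i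
  have hb2 := D.busy_mono (show i ≤ i + 1 by omega)
  rw [Nat.succ_eq_add_one, ← hs] at hl1
  rw [← hs] at hlev hl hlL hmM ⊢
  simp only at hlev hl hlL hmM hl1 ⊢
  by_cases h1 : D.busy i ≤ l - 1
  · rw [settle_of_hold]
    · exact Prod.ext (by simp only; omega) (by simp only; omega)
    · rw [hφ _ (by omega) _ hmM, typeRule_eq_false hD, show l - 1 + m = i by omega]
      exact h1
  · obtain ⟨k, rfl⟩ : ∃ k, m = k + 1 := ⟨m - 1, by omega⟩
    rw [settle_of_dispatch, settle_of_hold]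
    · exact Prod.ext (by simp only; omega) (by simp only; omega)
    · rw [hφ _ (by omega) _ (by omega), typeRule_eq_false hD,
        show l - 1 + 1 + k = i by omega]
      omega
    · rw [hφ _ (by omega) _ hmM, D.typeRule_eq_true, hD.type2_iff,
        show l - 1 + (k + 1) = i by omega]
      omega

variable (D)

/-! ### Optimal pricing -/

theorem pathValue_boxPath (hc : D.cd = D.cr) {M : ℕ} {x : State → ℝ} (hx : ∀ s, 0 ≤ x s) :
    D.pathValue (D.boxPath D.L M) x = D.chainValue (fun i => D.serviceRate (D.clip D.L M i))
      (fun i => x (D.clip D.L M i)) (D.L + M) := by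
  rw [(D.isLevelPath_boxPath D.L M).pathValue_eq D hc (fun i h1 h2 => by
    rw [D.nth_boxPath h2]; exact D.serviceRate_clip_pos D.one_le_L le_rfl h1 h2) hx]
  rw [Nat.cast_zero, mul_zero, sub_zero]
  exact D.chainValue_congr (fun i _ h2 => by rw [D.nth_boxPath h2])
    fun i hi => by rw [D.nth_boxPath hi.le]

/-- Compactness of the product of the rate intervals, with a value that is continuous in the rates.
-/
theorem exists_isOptimalPricing (hc : D.cd = D.cr) (M : ℕ) :
    ∃ x, D.IsOptimalPricing (D.boxPath D.L M) x := by
  have hcomp : IsCompact (univ.pi fun _ : State => Icc 0 D.Lam) :=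
    isCompact_univ_pi fun _ => isCompact_Icc
  have hcont : ContinuousOn (fun x : State → ℝ => D.pathValue (D.boxPath D.L M) x)
      (univ.pi fun _ : State => Icc 0 D.Lam) := by
    have h1 : ContinuousOn (fun x : State → ℝ => D.chainValue
        (fun i => D.serviceRate (D.clip D.L M i)) (fun i => x (D.clip D.L M i)) (D.L + M))
        (univ.pi fun _ : State => Icc 0 D.Lam) := by
      have hw : ∀ i, Continuous fun x : State → ℝ => chainWeight
          (fun i => D.serviceRate (D.clip D.L M i)) (fun i => x (D.clip D.L M i)) i := fun i =>
        continuous_finsetProd _ fun j _ => (continuous_apply _).div_const _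
      unfold chainValue
      refine ContinuousOn.div (continuousOn_finsetSum _ fun i _ => (hw i).continuousOn.mul ?_)
        (continuous_finsetSum _ fun i _ => hw i).continuousOn fun x hx => ?_
      · unfold chainReward
        refine ContinuousOn.sub ?_ continuousOn_const
        split_ifs
        · exact D.revenue_continuousOn.comp (continuous_apply _).continuousOn
            fun x hx => hx _ (mem_univ _)
        · exact continuousOn_const
      · exact (sum_chainWeight_pos (fun i h1 h2 =>
          D.serviceRate_clip_pos D.one_le_L le_rfl h1 h2) fun i _ => (hx _ (mem_univ _)).1).ne'
    exact h1.congr fun x hx => D.pathValue_boxPath hc fun s => (hx s (mem_univ _)).1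
  obtain ⟨x, hx, hmax⟩ := hcomp.exists_isMaxOn ⟨fun _ => 0, fun _ _ => ⟨le_rfl, D.Lam_pos.le⟩⟩ hcont
  exact ⟨x, fun s => hx s (mem_univ _), fun y hy => hmax fun s _ => hy s⟩

variable {D}

/-- Rejecting at level `j` realises every shorter chain on the same path, so shorter chains compete
too, as `exists_bellman` requires. -/
theorem IsOptimalPricing.chainValue_le (hc : D.cd = D.cr) {M : ℕ} {x : State → ℝ}
    (hx : D.IsOptimalPricing (D.boxPath D.L M) x) {y : ℕ → ℝ} (hy : ∀ i, y i ∈ Icc 0 D.Lam) {j : ℕ}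
    (hj : j ≤ D.L + M) :
    D.chainValue (fun i => D.serviceRate (D.clip D.L M i)) y j ≤
      D.pathValue (D.boxPath D.L M) x := by
  have hz : ∀ s : State, (if s.1 + s.2 < j then y (s.1 + s.2) else 0) ∈ Icc 0 D.Lam := fun s => by
    split_ifs
    · exact hy _
    · exact ⟨le_rfl, D.Lam_pos.le⟩
  refine le_trans (le_of_eq ?_) (hx.2 _ hz)
  rw [D.pathValue_boxPath hc fun s => (hz s).1, D.chainValue_eq_of_zero hj]
  · exact D.chainValue_congr (fun _ _ _ => rfl) fun i hi => by rw [clip_level, if_pos hi]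
  · intro _
    rw [clip_level, if_neg (lt_irrefl _)]

theorem IsOptimalPricing.value_nonneg (hc : D.cd = D.cr) {M : ℕ} {x : State → ℝ}
    (hx : D.IsOptimalPricing (D.boxPath D.L M) x) : 0 ≤ D.pathValue (D.boxPath D.L M) x := by
  have := hx.chainValue_le hc (y := fun _ => 0) (fun _ => ⟨le_rfl, D.Lam_pos.le⟩) (Nat.zero_le _)
  simpa [chainValue, chainReward] using this

/-- If service cannot keep up with the cost of `M` waiting riders, an optimal pricing of a chain
rejects before level `M`. -/
theorem exists_reject {ρ x : ℕ → ℝ} {n M : ℕ} {B : ℝ} (hρ : ∀ i, 1 ≤ i → i ≤ n → 0 < ρ i)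
    (hB : ∀ i, 1 ≤ i → i ≤ n → ρ i ≤ B) (hB0 : 0 < B) (hM : B * D.fareMax ≤ D.cr * M) (hMn : M ≤ n)
    (hx : ∀ i, x i ∈ Icc 0 D.Lam) (hv : 0 ≤ D.chainValue ρ x n)
    (hopt : ∀ j ≤ n, D.chainValue ρ x j ≤ D.chainValue ρ x n) : ∃ i < M, x i = 0 := by
  by_contra! hne
  have hF := D.fareMax_pos
  have hM0 : M ≠ 0 := by
    rintro rfl
    rw [Nat.cast_zero, mul_zero] at hM
    exact absurd (mul_pos hB0 hF) (not_lt.2 hM)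
  obtain ⟨k, rfl⟩ : ∃ k, M = k + 1 := ⟨M - 1, by omega⟩
  have hx' : ∀ i < n, 0 ≤ x i := fun i _ => (hx i).1
  have hw : ∀ i ≤ n, 0 ≤ chainWeight ρ x i := fun i hi => chainWeight_nonneg hρ hx' hi
  -- Unnormalised value of the chain cut off after level `j`.
  obtain ⟨S, hS⟩ : ∃ S : ℕ → ℝ, S = fun j =>
    ∑ i ∈ Finset.range (j + 1), chainWeight ρ x i * D.chainReward x j i := ⟨_, rfl⟩
  have hSsucc : ∀ j, S (j + 1) = S j + (chainWeight ρ x j * D.revenue (x j) -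
      chainWeight ρ x (j + 1) * (D.cr * (j + 1 : ℕ))) := fun j => by
    simp only [hS]
    rw [Finset.sum_range_succ, Finset.sum_range_succ, Finset.sum_range_succ (n := j)]
    have e : ∀ i ∈ Finset.range j, chainWeight ρ x i * D.chainReward x (j + 1) i =
        chainWeight ρ x i * D.chainReward x j i := fun i hi => by
      have := Finset.mem_range.1 hi
      rw [chainReward, chainReward, if_pos (by omega), if_pos this]
    rw [Finset.sum_congr rfl e]
    simp only [chainReward, lt_irrefl, if_false, Nat.lt_succ_self, if_true]
    ring
  -- By detailed balance, fares paid on leaving level `j` are service flow out of `j + 1` times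
  -- `fareMax`, hence at most the cost of being in `j + 1`.
  have hgain : ∀ j, k ≤ j → j < n → chainWeight ρ x j * (x j * D.fareMax) ≤
      chainWeight ρ x (j + 1) * (D.cr * (j + 1 : ℕ)) := fun j hj hjn => by
    rw [← mul_assoc, ← chainWeight_succ (hρ (j + 1) (by omega) hjn), mul_assoc]
    refine mul_le_mul_of_nonneg_left ?_ (hw _ hjn)
    have h1 := mul_le_mul_of_nonneg_right (hB (j + 1) (by omega) hjn) hF.le
    have h2 : D.cr * (k + 1 : ℕ) ≤ D.cr * (j + 1 : ℕ) :=
      mul_le_mul_of_nonneg_left (by exact_mod_cast Nat.succ_le_succ hj) D.cr_pos.le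
    linarith
  have hlt : S (k + 1) < S k := by
    have hxk : 0 < x k := (hx k).1.lt_of_ne (hne k (by omega)).symm
    have hwk : 0 < chainWeight ρ x k := chainWeight_pos (n := k)
      (fun i h1 h2 => hρ i h1 (by omega)) (fun i hi => (hx i).1.lt_of_ne (hne i (by omega)).symm)
      le_rfl
    have h1 : chainWeight ρ x k * D.revenue (x k) < chainWeight ρ x k * (x k * D.fareMax) :=
      mul_lt_mul_of_pos_left (mul_lt_mul_of_pos_left (D.fare_lt (hx k) hxk) hxk) hwk
    rw [hSsucc]
    linarith [hgain k le_rfl (by omega)]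
  have hanti : ∀ j, k + 1 ≤ j → j ≤ n → S j ≤ S (k + 1) := fun j hj => by
    induction j, hj using Nat.le_induction with
    | base => exact fun _ => le_rfl
    | succ j hj ih =>
      intro hjn
      have h1 : chainWeight ρ x j * D.revenue (x j) ≤ chainWeight ρ x j * (x j * D.fareMax) :=
        mul_le_mul_of_nonneg_left (mul_le_mul_of_nonneg_left (D.fare_le (hx j)) (hx j).1)
          (hw j (by omega))
      rw [hSsucc]
      linarith [hgain j (by omega) hjn, ih (by omega)]
  have hSn : S n < S k := (hanti n hMn le_rfl).trans_lt hlt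
  have hWn := sum_chainWeight_pos hρ hx'
  have hWk := sum_chainWeight_pos (n := k) (fun i h1 h2 => hρ i h1 (by omega))
    fun i hi => hx' i (by omega)
  have hWle : ∑ i ∈ Finset.range (k + 1), chainWeight ρ x i ≤
      ∑ i ∈ Finset.range (n + 1), chainWeight ρ x i :=
    Finset.sum_le_sum_of_subset_of_nonneg (Finset.range_subset_range.2 (by omega))
      fun i hi _ => hw i (by have := Finset.mem_range.1 hi; omega)
  have e1 : S n = D.chainValue ρ x n * ∑ i ∈ Finset.range (n + 1), chainWeight ρ x i := by
    rw [chainValue, div_mul_cancel₀ _ hWn.ne', hS]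
  have e2 : S k = D.chainValue ρ x k * ∑ i ∈ Finset.range (k + 1), chainWeight ρ x i := by
    rw [chainValue, div_mul_cancel₀ _ hWk.ne', hS]
  have h1 := mul_le_mul_of_nonneg_right (hopt k (by omega)) hWk.le
  have h2 := mul_le_mul_of_nonneg_left hWle hv
  linarith

theorem reward_bound {V : ℝ} (hc : D.cd = D.cr) {s : State} {a d d' e : ℝ}
    (hr : D.serviceRate s * d ≤ e)
    (h : D.revenue a - a * d' + e ≤ V + D.cr * (s.1 + s.2 : ℕ)) :
    D.reward a s - a * d' + D.serviceRate s * d ≤ V := by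
  rw [D.reward_eq hc a rfl]
  linarith

theorem sub_fareMax_nonpos {a : ℝ} (ha : a ∈ Icc 0 D.Lam) : D.revenue a - a * D.fareMax ≤ 0 := by
  have := mul_le_mul_of_nonneg_left (D.fare_le ha) ha.1
  unfold revenue
  linarith

theorem IsOptimalPricing.exists_bellman (hc : D.cd = D.cr) {M : ℕ} {x : State → ℝ}
    (hx : D.IsOptimalPricing (D.boxPath D.L M) x) {V : ℝ}
    (hV : D.pathValue (D.boxPath D.L M) x < V) :
    ∃ δ : ℕ → ℝ, (∀ i, 0 ≤ δ i ∧ δ i ≤ D.fareMax) ∧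
      (∀ i ≤ D.L + M, D.serviceRate (D.clip D.L M i) * δ i ≤ V + D.cr * i) ∧
      ∀ i ≤ D.L + M, ∀ a ∈ Icc 0 D.Lam, D.revenue a - a * δ (i + 1) +
        D.serviceRate (D.clip D.L M i) * δ i ≤ V + D.cr * i :=
  D.exists_bellman (ρ := fun i => D.serviceRate (D.clip D.L M i)) (n := D.L + M) (V := V)
    (by simp only [clip_zero, serviceRate_zero])
    (fun _ h1 h2 => D.serviceRate_clip_pos D.one_le_L le_rfl h1 h2)
    fun _ hy _ hj => (hx.chainValue_le hc hy hj).trans_lt hV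

/-- With at most `M` riders in the queue, no policy beats an optimal pricing of the path. -/
theorem IsOptimalPricing.objective_le_of_bounded (hc : D.cd = D.cr) (hD : D.DiminishingReturns)
    {M : ℕ} {x : State → ℝ} (hx : D.IsOptimalPricing (D.boxPath D.L M) x) {q : Policy}
    {π : State → ℝ} {v : ℝ} (hq : D.Admissible q) (hπ : D.IsStationary q π)
    (hA : ∀ s : State, M < s.2 → π s = 0) (hv : D.HasObjective q π v) :
    v ≤ D.pathValue (D.boxPath D.L M) x := by
  -- The shooting argument needs a gain strictly above the optimum, so the bound is obtained in the
  -- limit.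
  refine le_of_forall_gt fun V hV => ?_
  obtain ⟨V', h1, h2⟩ := exists_between hV
  refine lt_of_le_of_lt ?_ h2
  obtain ⟨δ, hδ, -, hbell⟩ := hx.exists_bellman hc h1
  refine hπ.objective_le D hq hv δ hδ fun s hs => ?_
  have hsL : s.1 ≤ D.L := by
    by_contra h
    exact hs (hπ.support_states s (by omega))
  have hsM : s.2 ≤ M := by
    by_contra h
    exact hs (hA s (by omega))
  exact reward_bound hc (mul_le_mul_of_nonneg_right
    (hD.serviceRate_le_clip le_rfl hsL hsM) (hδ _).1)
    (hbell (s.1 + s.2) (by omega) _ (hq.rate_mem s.1 hsL s.2))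

/-- If `M` is large, no policy at all beats an optimal pricing of the path. -/
theorem IsOptimalPricing.objective_le (hc : D.cd = D.cr) (hD : D.DiminishingReturns)
    {M : ℕ} (hM : D.L * D.muBar * D.fareMax ≤ D.cr * M) {x : State → ℝ}
    (hx : D.IsOptimalPricing (D.boxPath D.L M) x) {q : Policy} {π : State → ℝ} {v : ℝ}
    (hq : D.Admissible q) (hπ : D.IsStationary q π) (hv : D.HasObjective q π v) :
    v ≤ D.pathValue (D.boxPath D.L M) x := by
  refine le_of_forall_gt fun V hV => ?_
  obtain ⟨V', h1, h2⟩ := exists_between hV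
  refine lt_of_le_of_lt ?_ h2
  have hV0 := (hx.value_nonneg hc).trans h1.le
  have hF := D.fareMax_pos
  obtain ⟨δ, hδ, hterm, hbell⟩ := hx.exists_bellman hc h1
  refine hπ.objective_le D hq hv (fun i => if i < M then δ i else D.fareMax) (C := D.fareMax)
    (fun i => by split_ifs; exacts [hδ i, ⟨hF.le, le_rfl⟩]) fun s hs => ?_
  have hsL : s.1 ≤ D.L := by
    by_contra h
    exact hs (hπ.support_states s (by omega))
  have hrate := hq.rate_mem s.1 hsL s.2
  have hfm := sub_fareMax_nonpos hrate
  by_cases hlt : s.1 + s.2 < M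
  · simp only [if_pos hlt]
    have hsM : s.2 ≤ M := by omega
    have hr := mul_le_mul_of_nonneg_right
      (hD.serviceRate_le_clip le_rfl hsL hsM) (hδ (s.1 + s.2)).1
    refine reward_bound hc hr ?_
    -- At level `M - 1` the next decrement is already `fareMax`: no request rate gains anything
    -- there, so the terminal inequality `hterm` is enough.
    split_ifs
    · exact hbell (s.1 + s.2) (by omega) _ hrate
    · have := hterm (s.1 + s.2) (by omega)
      linarith
  · simp only [if_neg hlt, if_neg (show ¬ s.1 + s.2 + 1 < M by omega)]
    refine reward_bound hc (e := D.L * D.muBar * D.fareMax)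
      (mul_le_mul_of_nonneg_right (D.serviceRate_le s.2 hsL) hF.le) ?_
    have : D.cr * M ≤ D.cr * (s.1 + s.2 : ℕ) :=
      mul_le_mul_of_nonneg_left (by exact_mod_cast not_lt.1 hlt) D.cr_pos.le
    linarith

/-! ### The returned policies -/

theorem pathRate_clip {M i : ℕ} (hi : i ≤ D.L + M) (x : State → ℝ) :
    pathRate (D.boxPath D.L M) x (D.clip D.L M i) =
      if i < D.L + M then x (D.clip D.L M i) else 0 := by
  have := (D.isLevelPath_boxPath D.L M).pathRate_nth hi x
  rwa [D.nth_boxPath hi] at this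

theorem pathRate_mem {x : State → ℝ} (hx : ∀ s, x s ∈ Icc 0 D.Lam) (P : List State) (s : State) :
    pathRate P x s ∈ Icc 0 D.Lam := by
  unfold pathRate
  split_ifs
  · exact hx s
  · exact ⟨le_rfl, D.Lam_pos.le⟩

theorem pathRate_off {M : ℕ} {x : State → ℝ} {s : State}
    (hs : s ≠ D.clip D.L M (s.1 + s.2)) : pathRate (D.boxPath D.L M) x s = 0 :=
  if_neg fun h => hs (D.mem_boxPath.1 (List.dropLast_subset _ h)).2

theorem exists_first_zero {y : ℕ → ℝ} (hy : ∀ i, 0 ≤ y i) {k : ℕ} (hk : y k = 0) :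
    ∃ n ≤ k, y n = 0 ∧ ∀ i < n, 0 < y i := by
  classical
  have hex : ∃ k, y k = 0 := ⟨k, hk⟩
  exact ⟨Nat.find hex, Nat.find_min' hex hk, Nat.find_spec hex, fun i hi =>
    (hy i).lt_of_ne (Ne.symm (Nat.find_min hex hi))⟩

/-- A policy with the request rates of the path that follows the path up to its first rejection
attains the value of the path, in a unique stationary regime. -/
theorem exists_regime (hc : D.cd = D.cr) (hD : D.DiminishingReturns) {M n : ℕ}
    (hn : n ≤ D.L + M) {x : State → ℝ} (hx : ∀ s, x s ∈ Icc 0 D.Lam) {φ : State → Bool}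
    (hφ : ∀ l ≤ D.L, ∀ m ≤ M, φ (l, m) = D.typeRule (l, m))
    (hrow : ∀ m, φ (0, m + 1) = true)
    (hright : ∀ i < n, (D.clip D.L M i).2 = M → φ ((D.clip D.L M i).1, M + 1) = true)
    (hzero : pathRate (D.boxPath D.L M) x (D.clip D.L M n) = 0)
    (hpos : ∀ i < n, 0 < pathRate (D.boxPath D.L M) x (D.clip D.L M i)) :
    ∃ π, D.IsStationary ⟨φ, pathRate (D.boxPath D.L M) x⟩ π ∧
      (∀ π', D.IsStationary ⟨φ, pathRate (D.boxPath D.L M) x⟩ π' → π' = π) ∧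
      (∀ s : State, M < s.2 → π s = 0) ∧
      D.HasObjective ⟨φ, pathRate (D.boxPath D.L M) x⟩ π (D.pathValue (D.boxPath D.L M) x) := by
  have h : D.IsPathRegime ⟨φ, pathRate (D.boxPath D.L M) x⟩ (D.clip D.L M) n :=
    { level_eq := fun i _ => D.clip_level D.L M i
      fst_le := fun i hi => D.clip_fst_le (by omega)
      hold := fun i hi => by
        have h1 := D.clip_fst_le (a := D.L) (b := M) (i := i) (by omega)
        exact (hφ _ h1 _ (D.clip_snd_le D.L M i)).trans (typeRule_clip hD M i)
      rate_pos := hpos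
      rate_last := hzero
      rate_off := fun s _ hs => pathRate_off hs
      up := fun i hi => settle_clip_up hD hφ (by omega) (hright i hi)
      down := fun i hi => settle_clip_down hD hφ (by omega)
      row_zero := hrow }
  refine ⟨_, h.isStationary, fun π' hπ' => h.unique hπ', fun s hs => pathLaw_off ?_, ?_⟩
  · rintro ⟨-, h2⟩
    have := D.clip_snd_le D.L M (s.1 + s.2)
    rw [← h2] at this
    omega
  · have h1 := h.hasObjective hc
    convert h1 using 1
    rw [D.pathValue_boxPath hc fun s => (hx s).1, ← D.chainValue_eq_of_zero hn fun _ => hzero]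
    exact D.chainValue_congr (fun _ _ _ => rfl) fun i hi =>
      ((pathRate_clip hi.le x).trans (if_pos hi)).symm

theorem admissible_pathPolicy (hD : D.DiminishingReturns) {M : ℕ} {x : State → ℝ}
    (hx : ∀ s, x s ∈ Icc 0 D.Lam) : D.Admissible (D.pathPolicy (D.boxPath D.L M) x) where
  rate_mem l _ m := pathRate_mem hx _ _
  hold_no_rider l hl := by
    refine (hD.pathDispatch_eq hl (Nat.zero_le _)).trans ?_
    rw [typeRule_eq_false hD]
    exact D.busy_le l
  hold_no_driver m := by simp [pathPolicy, pathDispatch]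

theorem admissible_typePolicy {r : State → ℝ} (hr : ∀ s, r s ∈ Icc 0 D.Lam) :
    D.Admissible ⟨D.typeRule, r⟩ where
  rate_mem l _ m := hr _
  hold_no_rider l _ := by simp [typeRule, Type2]
  hold_no_driver m := by simp [typeRule, Type2]

theorem IsOptimalPricing.exists_regime_pathPolicy (hc : D.cd = D.cr) (hD : D.DiminishingReturns)
    {M : ℕ} {x : State → ℝ} (hx : D.IsOptimalPricing (D.boxPath D.L M) x) :
    ∃ π, D.IsStationary (D.pathPolicy (D.boxPath D.L M) x) π ∧
      (∀ π', D.IsStationary (D.pathPolicy (D.boxPath D.L M) x) π' → π' = π) ∧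
      (∀ s : State, M < s.2 → π s = 0) ∧ D.HasObjective (D.pathPolicy (D.boxPath D.L M) x) π
        (D.pathValue (D.boxPath D.L M) x) := by
  obtain ⟨n, hn, hz, hp⟩ := exists_first_zero
    (y := fun i => pathRate (D.boxPath D.L M) x (D.clip D.L M i))
    (fun i => (pathRate_mem hx.1 _ _).1) (k := D.L + M)
    ((pathRate_clip le_rfl x).trans (if_neg (lt_irrefl _)))
  refine exists_regime hc hD hn hx.1 (fun l hl m hm => hD.pathDispatch_eq hl hm)
    (pathDispatch_row_zero M) (fun i hi hM => ?_) hz hp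
  have hlev := D.clip_level D.L M i
  refine pathDispatch_right (by omega) ?_
  rw [show ((D.clip D.L M i).1, M) = D.clip D.L M i from Prod.ext rfl hM.symm, mem_boxPath, hlev]
  exact ⟨by omega, rfl⟩

/-- The first rejection comes at a level below `M`, so before it the path does not touch the wall
and column `M + 1` is never entered. -/
theorem IsOptimalPricing.exists_regime_typePolicy (hc : D.cd = D.cr) (hD : D.DiminishingReturns)
    {M : ℕ} (hM : D.L * D.muBar * D.fareMax ≤ D.cr * M) {x : State → ℝ}
    (hx : D.IsOptimalPricing (D.boxPath D.L M) x) :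
    ∃ π, D.IsStationary ⟨D.typeRule, pathRate (D.boxPath D.L M) x⟩ π ∧
      (∀ π', D.IsStationary ⟨D.typeRule, pathRate (D.boxPath D.L M) x⟩ π' → π' = π) ∧
      (∀ s : State, M < s.2 → π s = 0) ∧
      D.HasObjective ⟨D.typeRule, pathRate (D.boxPath D.L M) x⟩ π
        (D.pathValue (D.boxPath D.L M) x) := by
  have hval := D.pathValue_boxPath hc (M := M) fun s => (hx.1 s).1
  obtain ⟨k, hkM, hk⟩ := exists_reject (D := D)
    (ρ := fun i => D.serviceRate (D.clip D.L M i)) (x := fun i => x (D.clip D.L M i))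
    (n := D.L + M) (M := M) (B := D.L * D.muBar)
    (fun _ h1 h2 => D.serviceRate_clip_pos D.one_le_L le_rfl h1 h2)
    (fun i _ h2 => D.serviceRate_le _ (D.clip_fst_le h2))
    (mul_pos (by exact_mod_cast D.one_le_L) D.muBar_pos) hM (by omega) (fun i => hx.1 _)
    (by rw [← hval]; exact hx.value_nonneg hc)
    fun j hj => by rw [← hval]; exact hx.chainValue_le hc (fun i => hx.1 _) hj
  obtain ⟨n, hn, hz, hp⟩ := exists_first_zero
    (y := fun i => pathRate (D.boxPath D.L M) x (D.clip D.L M i))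
    (fun i => (pathRate_mem hx.1 _ _).1) (k := k)
    (by rw [pathRate_clip (by omega), hk, ite_self])
  refine exists_regime hc hD (by omega) hx.1 (fun l _ m _ => rfl) (typeRule_row_zero hD)
    (fun i hi hMi => ?_) hz hp
  have := D.clip_level D.L M i
  omega

end Model

end SpatialQueue

end

/-! ### The main theorem. -/

theorem theorem2 (D : SpatialQueue.Model) (hD : D.DiminishingReturns) (hc : D.cd = D.cr) (M : ℕ) :
    -- the returned path follows the zigzag path of the type rule as long as that path is in the table
    (∀ k, (SpatialQueue.Model.zigzag D.typeRule k).2 ≤ M →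
      (D.outputPath M)[k]? = some (SpatialQueue.Model.zigzag D.typeRule k)) ∧
    -- the returned dispatching policy holds on type 1 states and dispatches on type 2 states
    (∀ l ≤ D.L, ∀ m ≤ M,
      (D.Type1 (l, m) → D.pathDispatch (D.outputPath M) (l, m) = false) ∧
      (D.Type2 (l, m) → D.pathDispatch (D.outputPath M) (l, m) = true)) ∧
    -- there is an optimal pricing along the returned path, and any such pricing makes an optimal policy
    (∃ x, D.IsOptimalPricing (D.outputPath M) x) ∧
    ∀ x, D.IsOptimalPricing (D.outputPath M) x →
      D.IsOptimalQueueBounded M (D.pathPolicy (D.outputPath M) x) ∧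
      (D.L * D.muBar * D.fareMax ≤ D.cr * M →
        D.IsOptimal (D.pathPolicy (D.outputPath M) x) ∧
        D.IsOptimal
          { dispatch := D.typeRule, rate := (D.pathPolicy (D.outputPath M) x).rate }) := by
  rw [D.outputPath_eq hc hD M]
  refine ⟨fun k hk => ?_, fun l hl m hm => ?_, D.exists_isOptimalPricing hc M, fun x hx => ?_⟩
  · have hL := D.busy_le_L k
    rw [D.zigzag_eq] at hk
    simp only at hk
    rw [D.boxPath_getElem? (by omega), D.clip_eq_zigzag hL hk]
  · rw [hD.pathDispatch_eq hl hm, D.typeRule_eq_true]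
    refine ⟨fun h => ?_, id⟩
    rw [SpatialQueue.Model.typeRule_eq_false hD]
    exact (hD.type1_iff hl).1 h
  · have hadm := SpatialQueue.Model.admissible_pathPolicy hD (M := M) hx.1
    obtain ⟨π, h1, h2, h3, h4⟩ := hx.exists_regime_pathPolicy hc hD
    refine ⟨⟨hadm, π, _, h1, h2, h3, h4, fun q π' v hq hπ' hA hv =>
      hx.objective_le_of_bounded hc hD hq hπ' hA hv⟩, fun hM => ⟨⟨hadm, π, _, h1, h2, trivial, h4,
      fun q π' v hq hπ' _ hv => hx.objective_le hc hD hM hq hπ' hv⟩, ?_⟩⟩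
    obtain ⟨π, h1, h2, -, h4⟩ := hx.exists_regime_typePolicy hc hD hM
    exact ⟨SpatialQueue.Model.admissible_typePolicy fun s =>
      SpatialQueue.Model.pathRate_mem hx.1 _ s, π, _, h1, h2, trivial, h4,
      fun q π' v hq hπ' _ hv => hx.objective_le hc hD hM hq hπ' hv⟩
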